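/- Let $d\in\mathbb N$ and let $\Omega\subset\mathbb R^d$ be a nonempty, bounded, convex open set with $C^2$ boundary and outward unit normal $\boldsymbol n$ on $\partial\Omega$. Let $0<\kappa_\star\le\kappa^\star$ and let $\kappa\in C^2(\overline\Omega)$ satisfy $\kappa_\star\le\kappa(\boldsymbol x)\le\kappa^\star$ for all $\boldsymbol x\in\overline\Omega$. Assume that: (i) $\kappa$ is normally non-increasing in a neighborhood of $\partial\Omega$, that is, there is $\ell_1>0$ such that for every $\overline{\boldsymbol x}\in\partial\Omega$ the function $\ell\mapsto\kappa(\overline{\boldsymbol x}-\ell\,\boldsymbol n(\overline{\boldsymbol x}))$ is non-decreasing on $[0,\ell_1]$ (with $\ell_1$ so small that these points lie in $\overline\Omega$); (ii) for every $\overline{\boldsymbol x}\in\partial\Omega$, either $\nabla\kappa(\overline{\boldsymbol x})\cdot\boldsymbol n(\overline{\boldsymbol x})<0$, or $\nabla\kappa(\overline{\boldsymbol x})\cdot\boldsymbol n(\overline{\boldsymbol x})=0$ and $D^2\kappa(\overline{\boldsymbol x})\boldsymbol n(\overline{\boldsymbol x})\cdot\boldsymbol n(\overline{\boldsymbol x})=0$.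 Then there exists a $C^2$ function $\widetilde\kappa:\mathbb R^d\to[\kappa_\star/2,\kappa^\star]$ with $\widetilde\kappa=\kappa$ on $\overline\Omega$ such that $$\widetilde\delta(\boldsymbol x,\boldsymbol y)=\inf_{\gamma}\Big(\int_0^1\frac{1}{\widetilde\kappa(\gamma(\tau))}|\gamma'(\tau)|^2\,\mathrm d\tau\Big)^{1/2},\qquad \boldsymbol x,\boldsymbol y\in\mathbb R^d,$$ where the infimum is over all $\gamma\in C^1([0,1];\mathbb R^d)$ with $\gamma(0)=\boldsymbol x$ and $\gamma(1)=\boldsymbol y$, is a distance on $\mathbb R^d$, and $\Omega$ is geodesically convex in $(\mathbb R^d,\widetilde\delta)$: any $\boldsymbol x,\boldsymbol y\in\Omega$ are joined by a minimizing geodesic, i.e. a path $\gamma$ as above with $\int_0^1\widetilde\kappa(\gamma)^{-1}|\gamma'|^2\,\mathrm d\tau=\widetilde\delta(\boldsymbol x,\boldsymbol y)^2$, and every such minimizing geodesic satisfies $\gamma([0,1])\subset\Omega$. -/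

import Mathlib

open Set

/-- `φ` is a `C²` defining function of `Ω` on the open neighbourhood `U` of the point `p`:
inside `U` the set `Ω` is the sublevel set `{φ < 0}`, and `∇φ(p) ≠ 0`. -/
structure IsLocalDefiningFunction {d : ℕ} (Ω : Set (EuclideanSpace ℝ (Fin d)))
    (p : EuclideanSpace ℝ (Fin d)) (U : Set (EuclideanSpace ℝ (Fin d)))
    (φ : EuclideanSpace ℝ (Fin d) → ℝ) : Prop where
  isOpen : IsOpen U
  mem : p ∈ U
  contDiffOn : ContDiffOn ℝ 2 φ U
  gradient_ne_zero : gradient φ p ≠ 0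
  mem_iff : ∀ z ∈ U, z ∈ Ω ↔ φ z < 0

/-- The boundary of (the open set) `Ω` is of class `C²`, with `Ω` locally on one side of it. -/
def HasC2Boundary {d : ℕ} (Ω : Set (EuclideanSpace ℝ (Fin d))) : Prop :=
  ∀ p ∈ frontier Ω, ∃ U φ, IsLocalDefiningFunction Ω p U φ

/-- `ν` is the outward-pointing unit normal of `Ω` at the boundary point `p`, that is
`ν = ∇φ(p) / |∇φ(p)|` for a local defining function `φ` (it does not depend on `φ`). -/
def IsOutwardUnitNormal {d : ℕ} (Ω : Set (EuclideanSpace ℝ (Fin d)))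
    (p ν : EuclideanSpace ℝ (Fin d)) : Prop :=
  ∃ U φ, IsLocalDefiningFunction Ω p U φ ∧ ν = ‖gradient φ p‖⁻¹ • gradient φ p

/-- `f` is normally non-increasing in a neighbourhood of `∂Ω`: it does not increase along the
outward normal lines, i.e. `ℓ ↦ f (p - ℓ n(p))` is non-decreasing on `[0, ℓ₁]`, with `ℓ₁ > 0`
independent of `p ∈ ∂Ω`.  (`ℓ₁` may always be shrunk, so that it can be taken below any given
positive bound.) -/
def NormallyNonincreasing {d : ℕ} (Ω : Set (EuclideanSpace ℝ (Fin d)))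
    (f : EuclideanSpace ℝ (Fin d) → ℝ) : Prop :=
  ∃ ℓ₁ : ℝ, 0 < ℓ₁ ∧ ∀ p ∈ frontier Ω, ∀ ν, IsOutwardUnitNormal Ω p ν →
    MonotoneOn (fun ℓ : ℝ => f (p - ℓ • ν)) (Icc 0 ℓ₁)

/-- `γ` is (on `[0,1]`) a `C¹` path from `x` to `y` in `ℝ^d`. -/
structure IsC1Path {d : ℕ} (x y : EuclideanSpace ℝ (Fin d))
    (γ : ℝ → EuclideanSpace ℝ (Fin d)) : Prop where
  contDiffOn : ContDiffOn ℝ 1 γ (Icc 0 1)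
  source : γ 0 = x
  target : γ 1 = y

/-- The energy `∫₀¹ κ(γ(τ))⁻¹ |γ'(τ)|² dτ` of a path. -/
noncomputable def conformalEnergy {d : ℕ} (κ : EuclideanSpace ℝ (Fin d) → ℝ)
    (γ : ℝ → EuclideanSpace ℝ (Fin d)) : ℝ :=
  ∫ τ in (0 : ℝ)..1, 1 / κ (γ τ) * ‖derivWithin γ (Icc 0 1) τ‖ ^ 2

/-- The distance of the conformal Riemannian metric with weight `1/κ`: the infimum of the square
root of the energy over the `C¹` paths from `x` to `y`. -/
noncomputable def conformalDist {d : ℕ} (κ : EuclideanSpace ℝ (Fin d) → ℝ)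
    (x y : EuclideanSpace ℝ (Fin d)) : ℝ :=
  sInf {r : ℝ | ∃ γ, IsC1Path x y γ ∧ r = Real.sqrt (conformalEnergy κ γ)}

/-- `δ` is a distance function. -/
structure IsDistance {X : Type*} (δ : X → X → ℝ) : Prop where
  nonneg : ∀ x y, 0 ≤ δ x y
  eq_zero_iff : ∀ x y, δ x y = 0 ↔ x = y
  symm : ∀ x y, δ x y = δ y x
  triangle : ∀ x y z, δ x z ≤ δ x y + δ y z

/-- `γ` is a minimizing geodesic from `x` to `y` for the distance `conformalDist κ`. -/
def IsMinimizingGeodesic {d : ℕ} (κ : EuclideanSpace ℝ (Fin d) → ℝ)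
    (x y : EuclideanSpace ℝ (Fin d)) (γ : ℝ → EuclideanSpace ℝ (Fin d)) : Prop :=
  IsC1Path x y γ ∧ conformalDist κ x y ^ 2 = conformalEnergy κ γ

/-- `Ω` is geodesically convex in `(ℝ^d, conformalDist κ)`: any two points of `Ω` are joined by a
minimizing geodesic, and every minimizing geodesic between them stays in `Ω`. -/
def IsGeodesicallyConvex {d : ℕ} (κ : EuclideanSpace ℝ (Fin d) → ℝ)
    (Ω : Set (EuclideanSpace ℝ (Fin d))) : Prop :=
  ∀ x ∈ Ω, ∀ y ∈ Ω, (∃ γ, IsMinimizingGeodesic κ x y γ) ∧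
    ∀ γ, IsMinimizingGeodesic κ x y γ → ∀ t ∈ Icc (0 : ℝ) 1, γ t ∈ Ω

/-!
The function `κ` is first extended to a `C²` function on the whole space, then corrected outside
`Ω` so that it does not increase along *any* outward normal ray. Geodesic convexity is then a
maximum principle for the signed distance to the boundary along geodesics.

*Gauge.* Everything near `∂Ω` is expressed by the gauge `g` of `Ω` about some `x₀ ∈ Ω`: a convex
function, homogeneous about `x₀`, with `Ω = {g < 1}`. It is `C²` away from `x₀`, since `1 / g`
solves `φ (x₀ + t (x - x₀)) = 0` for `t` and the radial derivative of a defining function `φ` of a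
convex set does not vanish (`exists_isRadialGauge`). In particular `g - 1` is a global defining
function, and the outward normal is `∇g / |∇g|`.

*Extension and correction.* Near `∂Ω` the extension is `3 κ(x - Z) - 3 κ(x - 2Z) + κ(x - 3Z)`,
where `Z = (1 - 1 / g) (x - x₀)`; this matches `κ` to second order on `∂Ω`
(`IsRadialGauge.exists_contDiff_extension`). By the boundary condition and compactness of `∂Ω`,
its normal derivative at `p + r n(p)` is at most `o(r)` as `r → 0+`, uniformly in `p`
(`IsRadialGauge.normal_derivative_le`). A function which is `o(s)` is dominated by `θ'` for some
nondecreasing `C²` function `θ` vanishing on `(-∞, 0]` (`exists_contDiff_deriv_ge`), so subtracting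
`θ (g - 1)` makes the normal derivative nonpositive near `∂Ω`; a nonincreasing cutoff in `g`
interpolates towards the constant lower bound further out
(`IsRadialGauge.exists_antitone_correction`). Each exterior point lies on an outward normal ray, so
the upper bound of `κ` on `∂Ω` persists outside.

*Geodesics.* With `w = 1 / κ`, the direct method in the Hilbert space of square-integrable
velocities yields a path of least energy (`exists_minimal_velocity`). The du Bois-Reymond form of
the Euler-Lagrange equation (`euler_lagrange`) says that the momentum `w(γ) γ'` is a primitive of
`½ |γ'|² ∇w(γ)`; hence minimizers are `C¹`, the infimum over `C¹` paths is attained, and it agrees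
with the infimum over all paths of finite energy (`exists_conformalDist_sq_eq`). The latter class
is stable under concatenation, which gives the triangle inequality.

*Maximum principle.* The signed distance `H` to `∂Ω` is convex: at `x = p + H(x) n(p)` it has the
subgradient `n(p)`. If `H` composed with a minimizing geodesic had a nonnegative maximum at an
interior time, there `⟨n, P⟩ = 0` for the momentum `P`, while `⟨n, P⟩' = ½ |γ'|² ∂ₙw ≥ 0`
because `κ` does not increase in the direction `n`: outside `Ω` by construction, and inside near
`∂Ω` because `κ` is normally non-increasing there. A small strictly convex perturbation turns this
into a contradiction (`isGeodesicallyConvex_of_subgradient`).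
-/

open MeasureTheory Filter Topology

/-! ### Paths with square-integrable velocity and their energy -/

section Variational

variable {E : Type*} [NormedAddCommGroup E] [InnerProductSpace ℝ E]

/-- Bounded sequences in a separable Hilbert space have weakly convergent subsequences. -/
theorem exists_subseq_tendsto_inner {H : Type*} [NormedAddCommGroup H] [InnerProductSpace ℝ H]
    [CompleteSpace H] [TopologicalSpace.SeparableSpace H] (f : ℕ → H) (C : ℝ)
    (hf : ∀ n, ‖f n‖ ≤ C) :
    ∃ (u : H) (k : ℕ → ℕ), StrictMono k ∧
      ∀ v, Tendsto (fun n => inner ℝ (f (k n)) v) atTop (𝓝 (inner ℝ u v)) := by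
  have hS := WeakDual.isSeqCompact_closedBall ℝ H (0 : StrongDual ℝ H) C
  obtain ⟨φ, -, k, hk, hlim⟩ := @hS
    (fun n => StrongDual.toWeakDual (InnerProductSpace.toDual ℝ H (f n)))
    (fun n => by
      rw [mem_preimage, mem_closedBall_zero_iff]
      exact ((InnerProductSpace.toDual ℝ H).norm_map (f n)).trans_le (hf n))
  refine ⟨(InnerProductSpace.toDual ℝ H).symm (WeakDual.toStrongDual φ), k, hk, fun v => ?_⟩
  have h := (WeakDual.eval_continuous v).continuousAt.tendsto.comp hlim
  rw [InnerProductSpace.toDual_symm_apply]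
  exact h

/-- In finite dimension weak convergence is convergence. -/
theorem tendsto_of_forall_tendsto_inner [FiniteDimensional ℝ E] {z : ℕ → E} {z₀ : E}
    (h : ∀ c : E, Tendsto (fun n => inner ℝ c (z n)) atTop (𝓝 (inner ℝ c z₀))) :
    Tendsto z atTop (𝓝 z₀) := by
  let b := stdOrthonormalBasis ℝ E
  rw [← b.sum_repr' z₀]
  refine Tendsto.congr (fun n => b.sum_repr' (z n)) ?_
  exact tendsto_finsetSum _ fun i _ => (h (b i)).smul_const _

/-- Lebesgue measure on the unit interval. -/
noncomputable abbrev unitMeasure : Measure ℝ := volume.restrict (Ioc (0 : ℝ) 1)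

/-- The path starting at `x` with velocity `u`. -/
noncomputable def pathOf (x : E) (u : ℝ → E) (t : ℝ) : E := x + ∫ s in (0 : ℝ)..t, u s

/-- The energy `∫₀¹ w(γ) |γ'|²` of the path `γ` starting at `x` with velocity `u`. -/
noncomputable def pathEnergy (w : E → ℝ) (x : E) (u : ℝ → E) : ℝ :=
  ∫ t, w (pathOf x u t) * ‖u t‖ ^ 2 ∂unitMeasure

/-- `u` is a square-integrable velocity field leading from `x` to `y` in unit time. -/
structure IsVelocity (x y : E) (u : ℝ → E) : Prop where
  memLp : MemLp u 2 unitMeasure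
  target : pathOf x u 1 = y

theorem pathOf_zero (x : E) (u : ℝ → E) : pathOf x u 0 = x := by simp [pathOf]

theorem continuousOn_pathOf {x : E} {u : ℝ → E} (hu : Integrable u unitMeasure) :
    ContinuousOn (pathOf x u) (Icc 0 1) := by
  have h : IntegrableOn u (uIcc 0 1) volume := by
    rw [uIcc_of_le zero_le_one, integrableOn_Icc_iff_integrableOn_Ioc]; exact hu
  have := intervalIntegral.continuousOn_primitive_interval h
  rw [uIcc_of_le zero_le_one] at this
  exact continuousOn_const.add this

theorem ContinuousOn.aestronglyMeasurable_unit {F : Type*} [TopologicalSpace F]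
    [TopologicalSpace.PseudoMetrizableSpace F] [SecondCountableTopology F] {f : ℝ → F}
    (hf : ContinuousOn f (Icc 0 1)) : AEStronglyMeasurable f unitMeasure :=
  (hf.aestronglyMeasurable measurableSet_Icc).mono_measure
    (Measure.restrict_mono Ioc_subset_Icc_self le_rfl)

theorem pathOf_congr_ae {x : E} {u v : ℝ → E} (h : u =ᵐ[unitMeasure] v) {t : ℝ}
    (ht : t ∈ Icc (0 : ℝ) 1) : pathOf x u t = pathOf x v t := by
  unfold pathOf
  congr 1
  rw [intervalIntegral.integral_of_le ht.1, intervalIntegral.integral_of_le ht.1]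
  exact integral_congr_ae (ae_restrict_of_ae_restrict_of_subset (Ioc_subset_Ioc_right ht.2) h)

theorem pathEnergy_congr_ae {w : E → ℝ} {x : E} {u v : ℝ → E} (h : u =ᵐ[unitMeasure] v) :
    pathEnergy w x u = pathEnergy w x v := by
  refine integral_congr_ae ?_
  filter_upwards [h, ae_restrict_mem measurableSet_Ioc] with t ht ht'
  rw [pathOf_congr_ae h (Ioc_subset_Icc_self ht'), ht]

theorem intervalIntegrable_of_unit {F : Type*} [NormedAddCommGroup F] {u : ℝ → F}
    (hu : Integrable u unitMeasure) {s t : ℝ} (hs : s ∈ Icc (0 : ℝ) 1) (ht : t ∈ Icc (0 : ℝ) 1) :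
    IntervalIntegrable u volume s t := by
  rw [intervalIntegrable_iff]
  refine hu.mono_measure (Measure.restrict_mono ?_ le_rfl)
  exact Ioc_subset_Ioc (le_min hs.1 ht.1) (max_le hs.2 ht.2)

theorem pathOf_add_smul (x : E) {u v : ℝ → E} (hu : Integrable u unitMeasure)
    (hv : Integrable v unitMeasure) (ε : ℝ) {t : ℝ} (ht : t ∈ Icc (0 : ℝ) 1) :
    pathOf x (fun s => u s + ε • v s) t = pathOf x u t + ε • pathOf 0 v t := by
  have h0 : (0 : ℝ) ∈ Icc (0 : ℝ) 1 := left_mem_Icc.2 zero_le_one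
  have h : ∫ s in (0 : ℝ)..t, (u s + ε • v s) = (∫ s in (0 : ℝ)..t, u s) +
      ∫ s in (0 : ℝ)..t, ε • v s :=
    intervalIntegral.integral_add (intervalIntegrable_of_unit hu h0 ht)
      ((intervalIntegrable_of_unit hv h0 ht).smul ε)
  rw [pathOf, h, intervalIntegral.integral_smul, pathOf, pathOf, zero_add, add_assoc]

variable {w : E → ℝ} {a b : ℝ}

theorem integrable_weight_mul (hw : Continuous w) (hab : ∀ z, w z ∈ Icc a b) {x : E} {u : ℝ → E}
    (hu : Integrable u unitMeasure) {g : ℝ → ℝ} (hg : Integrable g unitMeasure) :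
    Integrable (fun t => w (pathOf x u t) * g t) unitMeasure := by
  refine hg.bdd_mul (c := max |a| |b|)
    (hw.comp_continuousOn (continuousOn_pathOf hu)).aestronglyMeasurable_unit ?_
  exact ae_of_all _ fun t => abs_le_max_abs_abs (hab _).1 (hab _).2

theorem integrable_pathEnergy (hw : Continuous w) (hab : ∀ z, w z ∈ Icc a b) {x : E} {u : ℝ → E}
    (hu : MemLp u 2 unitMeasure) :
    Integrable (fun t => w (pathOf x u t) * ‖u t‖ ^ 2) unitMeasure :=
  integrable_weight_mul hw hab (hu.integrable one_le_two) (by simpa using hu.norm.integrable_sq)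

theorem pathEnergy_nonneg (hw : ∀ z, 0 ≤ w z) (x : E) (u : ℝ → E) : 0 ≤ pathEnergy w x u :=
  integral_nonneg fun _ => mul_nonneg (hw _) (sq_nonneg _)

end Variational

/-! ### Existence of paths of least energy -/

section Existence

variable {E : Type*} [NormedAddCommGroup E] [InnerProductSpace ℝ E] [FiniteDimensional ℝ E]
variable {w : E → ℝ} {a b : ℝ}

/-- Evaluating a path at time `t` is an `L²` pairing of its velocity with an indicator function, so
it is continuous for the weak topology. -/
theorem inner_indicator_eq (c : E) (f : Lp E 2 unitMeasure) (x : E) {t : ℝ}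
    (ht : t ∈ Icc (0 : ℝ) 1) :
    inner ℝ f (indicatorConstLp 2 (measurableSet_Ioc : MeasurableSet (Ioc (0 : ℝ) t))
      (measure_ne_top unitMeasure _) c) = inner ℝ c (pathOf x f t - x) := by
  rw [real_inner_comm, L2.inner_indicatorConstLp_eq_inner_setIntegral ℝ, pathOf,
    add_sub_cancel_left, intervalIntegral.integral_of_le ht.1,
    Measure.restrict_restrict measurableSet_Ioc,
    inter_eq_self_of_subset_left (Ioc_subset_Ioc_right ht.2)]

/-- If velocities converge weakly in `L²`, the paths converge pointwise. -/
theorem tendsto_pathOf {f : ℕ → Lp E 2 unitMeasure} {f₀ : Lp E 2 unitMeasure}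
    (h : ∀ v, Tendsto (fun n => inner ℝ (f n) v) atTop (𝓝 (inner ℝ f₀ v))) (x : E) {t : ℝ}
    (ht : t ∈ Icc (0 : ℝ) 1) :
    Tendsto (fun n => pathOf x (f n) t) atTop (𝓝 (pathOf x f₀ t)) := by
  have : Tendsto (fun n => pathOf x (f n) t - x) atTop (𝓝 (pathOf x f₀ t - x)) := by
    refine tendsto_of_forall_tendsto_inner fun c => ?_
    simp_rw [← inner_indicator_eq c _ x ht]
    exact h _
  simpa using this.add_const x

/-- The energy is sequentially lower semicontinuous for the weak convergence of velocities:
`∫ wₙ|uₙ|² ≥ ∫ 2wₙ⟨uₙ, u⟩ - wₙ|u|²`, and `wₙ u → w u` strongly in `L²`. -/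
theorem pathEnergy_le_of_tendsto (hw : Continuous w) (hab : ∀ z, w z ∈ Icc a b) (ha : 0 < a)
    {f : ℕ → Lp E 2 unitMeasure} {f₀ : Lp E 2 unitMeasure} {C : ℝ} (hC : ∀ n, ‖f n‖ ≤ C)
    (h : ∀ v, Tendsto (fun n => inner ℝ (f n) v) atTop (𝓝 (inner ℝ f₀ v))) (x : E) {I : ℝ}
    (hI : Tendsto (fun n => pathEnergy w x (f n)) atTop (𝓝 I)) :
    pathEnergy w x f₀ ≤ I := by
  have hmem : ∀ g : Lp E 2 unitMeasure, MemLp g 2 unitMeasure := Lp.memLp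
  have hint : ∀ g : Lp E 2 unitMeasure, Integrable g unitMeasure := fun g =>
    (hmem g).integrable one_le_two
  have hmeas : ∀ g : Lp E 2 unitMeasure,
      AEStronglyMeasurable (fun t => w (pathOf x g t)) unitMeasure := fun g =>
    (hw.comp_continuousOn (continuousOn_pathOf (hint g))).aestronglyMeasurable_unit
  have hbd : ∀ z, ‖w z‖ ≤ b := fun z => by
    rw [Real.norm_of_nonneg (ha.le.trans (hab z).1)]; exact (hab z).2
  have hG : ∀ g : Lp E 2 unitMeasure,
      MemLp (fun t => w (pathOf x g t) • f₀ t) 2 unitMeasure := fun g =>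
    (hmem f₀).of_le_mul (c := b) ((hmeas g).smul (hmem f₀).1) <| ae_of_all _ fun t => by
      rw [norm_smul]; exact mul_le_mul_of_nonneg_right (hbd _) (norm_nonneg _)
  have hlimw : ∀ᵐ t ∂unitMeasure,
      Tendsto (fun n => w (pathOf x (f n) t)) atTop (𝓝 (w (pathOf x f₀ t))) := by
    filter_upwards [ae_restrict_mem measurableSet_Ioc] with t ht
    exact (hw.tendsto _).comp (tendsto_pathOf h x (Ioc_subset_Icc_self ht))
  have hsq : Integrable (fun t => ‖f₀ t‖ ^ 2) unitMeasure := (hmem f₀).norm.integrable_sq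
  -- the second term converges by dominated convergence
  have h1 : Tendsto (fun n => ∫ t, w (pathOf x (f n) t) * ‖f₀ t‖ ^ 2 ∂unitMeasure) atTop
      (𝓝 (pathEnergy w x f₀)) := by
    refine tendsto_integral_of_dominated_convergence (fun t => b * ‖f₀ t‖ ^ 2)
      (fun n => (hmeas _).mul hsq.1) (hsq.const_mul b) (fun n => ae_of_all _ fun t => ?_) ?_
    · rw [norm_mul, Real.norm_of_nonneg (sq_nonneg _)]
      exact mul_le_mul_of_nonneg_right (hbd _) (sq_nonneg _)
    · filter_upwards [hlimw] with t ht using ht.mul_const _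
  -- `wₙ u → w u` strongly in `L²`
  have h2 : Tendsto (fun n => (hG (f n)).toLp - (hG f₀).toLp) atTop (𝓝 0) := by
    rw [tendsto_zero_iff_norm_tendsto_zero]
    have : Tendsto (fun n => ‖(hG (f n)).toLp - (hG f₀).toLp‖ ^ 2) atTop (𝓝 0) := by
      have hform : ∀ n, ‖(hG (f n)).toLp - (hG f₀).toLp‖ ^ 2 =
          ∫ t, (w (pathOf x (f n) t) - w (pathOf x f₀ t)) ^ 2 * ‖f₀ t‖ ^ 2 ∂unitMeasure := by
        intro n
        rw [← real_inner_self_eq_norm_sq, L2.inner_def]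
        refine integral_congr_ae ?_
        filter_upwards [Lp.coeFn_sub (hG (f n)).toLp (hG f₀).toLp, (hG (f n)).coeFn_toLp,
          (hG f₀).coeFn_toLp] with t h1 h2 h3
        rw [h1, Pi.sub_apply, h2, h3, ← sub_smul, real_inner_self_eq_norm_sq, norm_smul, mul_pow,
          Real.norm_eq_abs, sq_abs]
      simp_rw [hform]
      rw [← integral_zero ℝ ℝ (μ := unitMeasure)]
      refine tendsto_integral_of_dominated_convergence (fun t => (b + b) ^ 2 * ‖f₀ t‖ ^ 2)
        (fun n => (((hmeas _).sub (hmeas _)).pow 2).mul hsq.1) (hsq.const_mul _)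
        (fun n => ae_of_all _ fun t => ?_) ?_
      · rw [norm_mul, Real.norm_of_nonneg (sq_nonneg ‖_‖), norm_pow]
        gcongr
        exact (norm_sub_le _ _).trans (add_le_add (hbd _) (hbd _))
      · filter_upwards [hlimw] with t ht
        simpa using ((ht.sub_const (w (pathOf x f₀ t))).pow 2).mul_const (‖f₀ t‖ ^ 2)
    simpa using this.sqrt
  have h3 : Tendsto (fun n => inner ℝ (f n) (hG (f n)).toLp) atTop
      (𝓝 (inner ℝ f₀ (hG f₀).toLp)) := by
    have hz : Tendsto (fun n => inner ℝ (f n) ((hG (f n)).toLp - (hG f₀).toLp)) atTop (𝓝 0) := by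
      refine squeeze_zero_norm (fun n => (norm_inner_le_norm _ _).trans
        (mul_le_mul_of_nonneg_right (hC n) (norm_nonneg _))) ?_
      simpa using h2.norm.const_mul C
    simpa [inner_sub_right] using hz.add (h (hG f₀).toLp)
  have hinner : ∀ g : Lp E 2 unitMeasure, inner ℝ g (hG g).toLp =
      ∫ t, w (pathOf x g t) * inner ℝ (g t) (f₀ t) ∂unitMeasure := by
    intro g
    rw [L2.inner_def]
    refine integral_congr_ae ?_
    filter_upwards [(hG g).coeFn_toLp] with t ht
    rw [ht, inner_smul_right]
  have h4 : inner ℝ f₀ (hG f₀).toLp = pathEnergy w x f₀ := by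
    rw [hinner]
    simp only [real_inner_self_eq_norm_sq, pathEnergy]
  have h5 : ∀ n, 2 * inner ℝ (f n) (hG (f n)).toLp -
      ∫ t, w (pathOf x (f n) t) * ‖f₀ t‖ ^ 2 ∂unitMeasure ≤ pathEnergy w x (f n) := by
    intro n
    rw [hinner, ← integral_const_mul, ← integral_sub]
    · refine integral_mono ?_ (integrable_pathEnergy hw hab (hmem _)) fun t => ?_
      · exact ((integrable_weight_mul hw hab (hint _) (L2.integrable_inner (f n) f₀)).const_mul
          2).sub (integrable_weight_mul hw hab (hint _) hsq)
      · have h0 : 0 ≤ w (pathOf x (f n) t) := ha.le.trans (hab _).1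
        have := mul_nonneg h0 (sq_nonneg ‖f n t - f₀ t‖)
        rw [norm_sub_sq_real] at this
        dsimp only
        linarith
    · exact (integrable_weight_mul hw hab (hint _) (L2.integrable_inner (f n) f₀)).const_mul 2
    · exact integrable_weight_mul hw hab (hint _) hsq
  have h6 := le_of_tendsto_of_tendsto' ((h3.const_mul 2).sub h1) hI h5
  rw [h4] at h6
  linarith

/-- The direct method: there is a velocity of least energy among those leading from `x` to `y`. -/
theorem exists_minimal_velocity (hw : Continuous w) (hab : ∀ z, w z ∈ Icc a b) (ha : 0 < a)
    (x y : E) :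
    ∃ u, IsVelocity x y u ∧ ∀ v, IsVelocity x y v → pathEnergy w x u ≤ pathEnergy w x v := by
  have hw0 : ∀ z, 0 ≤ w z := fun z => ha.le.trans (hab z).1
  let S : Set ℝ := {r | ∃ v, IsVelocity x y v ∧ pathEnergy w x v = r}
  have hne : S.Nonempty := ⟨_, fun _ => y - x, ⟨memLp_const _, by simp [pathOf]⟩, rfl⟩
  have hbdd : BddBelow S := ⟨0, by rintro _ ⟨v, -, rfl⟩; exact pathEnergy_nonneg hw0 x v⟩
  obtain ⟨r, hr, hlim, hmem⟩ := exists_seq_tendsto_sInf hne hbdd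
  choose v hv hvr using hmem
  let f : ℕ → Lp E 2 unitMeasure := fun n => (hv n).memLp.toLp
  have hfv : ∀ n, f n =ᵐ[unitMeasure] v n := fun n => (hv n).memLp.coeFn_toLp
  have hfE : ∀ n, pathEnergy w x (f n) = r n := fun n => by
    rw [pathEnergy_congr_ae (hfv n), hvr]
  have hfC : ∀ n, ‖f n‖ ≤ Real.sqrt (r 0 / a) := by
    intro n
    refine Real.le_sqrt_of_sq_le ?_
    rw [le_div_iff₀' ha, ← real_inner_self_eq_norm_sq, L2.inner_def, ← integral_const_mul]
    refine le_trans ?_ ((hfE n).le.trans (hr (Nat.zero_le n)))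
    refine integral_mono ((L2.integrable_inner _ _).const_mul a)
      (integrable_pathEnergy hw hab (Lp.memLp _)) fun t => ?_
    simp only [real_inner_self_eq_norm_sq]
    exact mul_le_mul_of_nonneg_right (hab _).1 (sq_nonneg _)
  have : Fact ((2 : ENNReal) ≠ ⊤) := ⟨by simp⟩
  have := FiniteDimensional.proper_real E
  obtain ⟨f₀, k, hk, hweak⟩ := exists_subseq_tendsto_inner f _ hfC
  refine ⟨f₀, ⟨Lp.memLp _, ?_⟩, fun z hz => ?_⟩
  · refine tendsto_nhds_unique (tendsto_pathOf hweak x (right_mem_Icc.2 zero_le_one)) ?_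
    refine tendsto_const_nhds.congr fun n => ?_
    rw [pathOf_congr_ae (hfv _) (right_mem_Icc.2 zero_le_one), (hv _).target]
  · refine le_trans ?_ (csInf_le hbdd ⟨z, hz, rfl⟩)
    refine pathEnergy_le_of_tendsto hw hab ha (fun n => hfC (k n)) hweak x ?_
    simp_rw [hfE]
    exact hlim.comp hk.tendsto_atTop

end Existence

/-! ### First variation and the Euler-Lagrange equation -/

section EulerLagrange

variable {E : Type*} [NormedAddCommGroup E] [InnerProductSpace ℝ E] [FiniteDimensional ℝ E]
variable {w : E → ℝ} {a b : ℝ}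

/-- Integration by parts for primitives of scalar integrable functions, which are only absolutely
continuous. -/
theorem integral_mul_primitive_add {f g : ℝ → ℝ} (hf : Integrable f unitMeasure)
    (hg : Integrable g unitMeasure) :
    ∫ t, (f t * (∫ s in (0 : ℝ)..t, g s) + (∫ s in (0 : ℝ)..t, f s) * g t) ∂unitMeasure =
      (∫ s in (0 : ℝ)..1, f s) * ∫ s in (0 : ℝ)..1, g s := by
  have h0 : (0 : ℝ) ∈ Icc (0 : ℝ) 1 := left_mem_Icc.2 zero_le_one
  have h1 : (1 : ℝ) ∈ Icc (0 : ℝ) 1 := right_mem_Icc.2 zero_le_one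
  have h0' : (0 : ℝ) ∈ uIcc (0 : ℝ) 1 := left_mem_uIcc
  have hf' := intervalIntegrable_of_unit hf h0 h1
  have hg' := intervalIntegrable_of_unit hg h0 h1
  have key := (hf'.absolutelyContinuousOnInterval_intervalIntegral
    h0').integral_deriv_mul_eq_sub (hg'.absolutelyContinuousOnInterval_intervalIntegral h0')
  simp only [intervalIntegral.integral_same, mul_zero, sub_zero] at key
  rw [← key, ← intervalIntegral.integral_of_le zero_le_one]
  refine intervalIntegral.integral_congr_ae ?_
  filter_upwards [hf'.ae_hasDerivAt_integral, hg'.ae_hasDerivAt_integral] with t hft hgt ht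
  rw [(hft (uIoc_subset_uIcc ht) 0 h0').deriv, (hgt (uIoc_subset_uIcc ht) 0 h0').deriv]

theorem inner_pathOf_zero (c : E) {u : ℝ → E} (hu : Integrable u unitMeasure) {t : ℝ}
    (ht : t ∈ Icc (0 : ℝ) 1) :
    inner ℝ c (pathOf 0 u t) = ∫ s in (0 : ℝ)..t, inner ℝ c (u s) := by
  have := (innerSL ℝ c).intervalIntegral_comp_comm
    (intervalIntegrable_of_unit hu (left_mem_Icc.2 zero_le_one) ht)
  rw [pathOf, zero_add]
  exact this.symm

theorem integrable_inner_pathOf {x : E} {f g : ℝ → E} (hf : Integrable f unitMeasure)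
    (hg : Integrable g unitMeasure) :
    Integrable (fun t => inner ℝ (f t) (pathOf x g t)) unitMeasure := by
  have hc := continuousOn_pathOf (x := x) hg
  obtain ⟨C, hC⟩ := isCompact_Icc.exists_bound_of_continuousOn hc
  refine (hf.norm.mul_const C).mono' (hf.1.inner hc.aestronglyMeasurable_unit) ?_
  filter_upwards [ae_restrict_mem measurableSet_Ioc] with t ht
  exact (norm_inner_le_norm _ _).trans
    (mul_le_mul_of_nonneg_left (hC t (Ioc_subset_Icc_self ht)) (norm_nonneg _))

/-- Integration by parts for primitives of integrable functions. -/
theorem integral_inner_pathOf_add {f g : ℝ → E} (hf : Integrable f unitMeasure)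
    (hg : Integrable g unitMeasure) :
    (∫ t, inner ℝ (f t) (pathOf 0 g t) ∂unitMeasure) +
      ∫ t, inner ℝ (g t) (pathOf 0 f t) ∂unitMeasure =
      inner ℝ (pathOf 0 f 1) (pathOf 0 g 1) := by
  let e := stdOrthonormalBasis ℝ E
  have h1 : (1 : ℝ) ∈ Icc (0 : ℝ) 1 := right_mem_Icc.2 zero_le_one
  rw [← integral_add (integrable_inner_pathOf hf hg) (integrable_inner_pathOf hg hf),
    ← e.sum_inner_mul_inner]
  have hi : ∀ i, Integrable (fun t => inner ℝ (e i) (f t) *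
      (∫ s in (0 : ℝ)..t, inner ℝ (e i) (g s)) +
      (∫ s in (0 : ℝ)..t, inner ℝ (e i) (f s)) * inner ℝ (e i) (g t)) unitMeasure := by
    intro i
    have hfi := hf.const_inner (𝕜 := ℝ) (e i)
    have hgi := hg.const_inner (𝕜 := ℝ) (e i)
    refine ((integrable_inner_pathOf (x := (0 : ℝ)) hgi hfi).add
      (integrable_inner_pathOf (x := (0 : ℝ)) hfi hgi)).congr (ae_of_all _ fun t => ?_)
    simp only [Pi.add_apply, pathOf, zero_add, RCLike.inner_apply, conj_trivial]
    ring
  have : ∀ i, inner ℝ (pathOf 0 f 1) (e i) * inner ℝ (e i) (pathOf 0 g 1) =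
      ∫ t, (inner ℝ (e i) (f t) * (∫ s in (0 : ℝ)..t, inner ℝ (e i) (g s)) +
        (∫ s in (0 : ℝ)..t, inner ℝ (e i) (f s)) * inner ℝ (e i) (g t)) ∂unitMeasure := by
    intro i
    rw [integral_mul_primitive_add (hf.const_inner (e i)) (hg.const_inner (e i)),
      real_inner_comm, inner_pathOf_zero _ hf h1, inner_pathOf_zero _ hg h1]
  simp_rw [this]
  rw [← integral_finsetSum _ fun i _ => hi i]
  refine integral_congr_ae ?_
  filter_upwards [ae_restrict_mem measurableSet_Ioc] with t ht
  have ht := Ioc_subset_Icc_self ht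
  rw [Finset.sum_add_distrib, ← e.sum_inner_mul_inner (f t), real_inner_comm (pathOf 0 f t),
    ← e.sum_inner_mul_inner (pathOf 0 f t)]
  congr 1 <;> refine Finset.sum_congr rfl fun i _ => ?_
  · rw [inner_pathOf_zero _ hg ht, real_inner_comm]
  · rw [real_inner_comm, inner_pathOf_zero _ hf ht]

/-- The first variation of the energy. -/
theorem hasDerivAt_pathEnergy (hw : ContDiff ℝ 1 w) (hab : ∀ z, w z ∈ Icc a b) (ha : 0 < a)
    (x : E) {u v : ℝ → E} (hu : MemLp u 2 unitMeasure) (hv : MemLp v 2 unitMeasure) :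
    Integrable (fun t => fderiv ℝ w (pathOf x u t) (pathOf 0 v t) * ‖u t‖ ^ 2 +
      w (pathOf x u t) * (2 * inner ℝ (u t) (v t))) unitMeasure ∧
    HasDerivAt (fun ε : ℝ => pathEnergy w x (fun t => u t + ε • v t))
      (∫ t, (fderiv ℝ w (pathOf x u t) (pathOf 0 v t) * ‖u t‖ ^ 2 +
        w (pathOf x u t) * (2 * inner ℝ (u t) (v t))) ∂unitMeasure) 0 := by
  have hui := hu.integrable one_le_two
  have hvi := hv.integrable one_le_two
  have hγ := continuousOn_pathOf (x := x) hui
  have hφ := continuousOn_pathOf (x := 0) hvi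
  have hdw : Continuous (fderiv ℝ w) := hw.continuous_fderiv one_ne_zero
  obtain ⟨R, hR⟩ := isCompact_Icc.exists_bound_of_continuousOn hγ
  obtain ⟨Φ, hΦ⟩ := isCompact_Icc.exists_bound_of_continuousOn hφ
  have := FiniteDimensional.proper_real E
  obtain ⟨L, hL⟩ := (isCompact_closedBall (0 : E) (R + Φ)).exists_bound_of_continuousOn
    hdw.continuousOn
  have hb : 0 < b := ha.trans_le ((hab 0).1.trans (hab 0).2)
  have hbd : ∀ z, ‖w z‖ ≤ b := fun z => by
    rw [Real.norm_of_nonneg (ha.le.trans (hab z).1)]; exact (hab z).2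
  have hcurve : ∀ ε : ℝ, ContinuousOn (fun t => pathOf x u t + ε • pathOf 0 v t) (Icc 0 1) :=
    fun ε => hγ.add (hφ.const_smul ε)
  have key := hasDerivAt_integral_of_dominated_loc_of_deriv_le (μ := unitMeasure) (𝕜 := ℝ)
    (x₀ := 0) (s := Metric.ball 0 1)
    (bound := fun t => L * Φ * (‖u t‖ + ‖v t‖) ^ 2 + b * (2 * ((‖u t‖ + ‖v t‖) * ‖v t‖)))
    (F := fun ε t => w (pathOf x u t + ε • pathOf 0 v t) * ‖u t + ε • v t‖ ^ 2)
    (F' := fun ε t => fderiv ℝ w (pathOf x u t + ε • pathOf 0 v t) (pathOf 0 v t) *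
      ‖u t + ε • v t‖ ^ 2 +
      w (pathOf x u t + ε • pathOf 0 v t) * (2 * inner ℝ (u t + ε • v t) (v t)))
    (Metric.ball_mem_nhds _ one_pos) ?_ ?_ ?_ ?_ ?_ ?_
  · simp only [zero_smul, add_zero] at key
    refine ⟨key.1, key.2.congr_of_eventuallyEq (Eventually.of_forall fun ε => ?_)⟩
    refine integral_congr_ae ?_
    filter_upwards [ae_restrict_mem measurableSet_Ioc] with t ht
    rw [pathOf_add_smul x hui hvi ε (Ioc_subset_Icc_self ht)]
  · refine Eventually.of_forall fun ε => ?_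
    exact (hw.continuous.comp_continuousOn (hcurve ε)).aestronglyMeasurable_unit.mul
      ((hu.1.add (hv.1.const_smul ε)).norm.pow 2)
  · simp only [zero_smul, add_zero]
    exact integrable_pathEnergy hw.continuous hab hu
  · simp only [zero_smul, add_zero]
    refine AEStronglyMeasurable.add (AEStronglyMeasurable.mul ?_ (hu.1.norm.pow 2))
      ((hw.continuous.comp_continuousOn hγ).aestronglyMeasurable_unit.mul
        ((hu.1.inner hv.1).const_mul 2))
    exact ((hdw.comp_continuousOn hγ).clm_apply hφ).aestronglyMeasurable_unit
  · filter_upwards [ae_restrict_mem measurableSet_Ioc] with t ht ε hε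
    have ht := Ioc_subset_Icc_self ht
    have hε1 : ‖ε‖ ≤ 1 := (mem_ball_zero_iff.1 hε).le
    have h1 : ‖u t + ε • v t‖ ≤ ‖u t‖ + ‖v t‖ := by
      refine (norm_add_le _ _).trans (add_le_add le_rfl ?_)
      rw [norm_smul]
      exact mul_le_of_le_one_left (norm_nonneg _) hε1
    have h2 : pathOf x u t + ε • pathOf 0 v t ∈ Metric.closedBall (0 : E) (R + Φ) := by
      rw [mem_closedBall_zero_iff]
      refine (norm_add_le _ _).trans (add_le_add (hR t ht) ?_)
      rw [norm_smul]
      exact (mul_le_of_le_one_left (norm_nonneg _) hε1).trans (hΦ t ht)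
    have h3 : ‖fderiv ℝ w (pathOf x u t + ε • pathOf 0 v t) (pathOf 0 v t)‖ ≤ L * Φ :=
      ((fderiv ℝ w _).le_opNorm _).trans (mul_le_mul (hL _ h2) (hΦ t ht) (norm_nonneg _)
        ((norm_nonneg _).trans (hL _ h2)))
    have h4 : ‖inner ℝ (u t + ε • v t) (v t)‖ ≤ (‖u t‖ + ‖v t‖) * ‖v t‖ :=
      (norm_inner_le_norm _ _).trans (mul_le_mul_of_nonneg_right h1 (norm_nonneg _))
    refine (norm_add_le _ _).trans (add_le_add ?_ ?_)
    · rw [norm_mul, norm_pow, norm_norm]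
      exact mul_le_mul h3 (pow_le_pow_left₀ (norm_nonneg _) h1 2) (by positivity)
        ((norm_nonneg _).trans h3)
    · rw [norm_mul, norm_mul, Real.norm_ofNat]
      gcongr
      exact hbd _
  · have hs : MemLp (fun t => ‖u t‖ + ‖v t‖) 2 unitMeasure := hu.norm.add hv.norm
    exact (hs.integrable_sq.const_mul _).add (((hs.integrable_mul hv.norm).const_mul 2).const_mul b)
  · refine ae_of_all _ fun t ε _ => ?_
    have h1 : HasDerivAt (fun ε : ℝ => pathOf x u t + ε • pathOf 0 v t) (pathOf 0 v t) ε := by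
      simpa using ((hasDerivAt_id ε).smul_const (pathOf 0 v t)).const_add (pathOf x u t)
    have h2 : HasDerivAt (fun ε : ℝ => u t + ε • v t) (v t) ε := by
      simpa using ((hasDerivAt_id ε).smul_const (v t)).const_add (u t)
    exact (((hw.differentiable one_ne_zero _).hasFDerivAt).comp_hasDerivAt ε h1).mul h2.norm_sq

/-- The momentum `w(γ) γ'` of an energy-minimizing velocity is the primitive of the force
`½ |γ'|² ∇w(γ)` (Euler-Lagrange equation in the integrated form of du Bois-Reymond). -/
theorem euler_lagrange (hw : ContDiff ℝ 1 w) (hab : ∀ z, w z ∈ Icc a b) (ha : 0 < a)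
    {x y : E} {u : ℝ → E} (hu : IsVelocity x y u)
    (hmin : ∀ v, IsVelocity x y v → pathEnergy w x u ≤ pathEnergy w x v) :
    Integrable (fun t => (‖u t‖ ^ 2 / 2) • gradient w (pathOf x u t)) unitMeasure ∧
    ∃ c : E, ∀ᵐ t ∂unitMeasure, w (pathOf x u t) • u t =
      pathOf c (fun s => (‖u s‖ ^ 2 / 2) • gradient w (pathOf x u s)) t := by
  have hu2 := hu.memLp
  have hui := hu2.integrable one_le_two
  have hγ := continuousOn_pathOf (x := x) hui
  have hgrad : Continuous (gradient w) :=
    (InnerProductSpace.toDual ℝ E).symm.continuous.comp (hw.continuous_fderiv one_ne_zero)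
  have hwγ : AEStronglyMeasurable (fun t => w (pathOf x u t)) unitMeasure :=
    (hw.continuous.comp_continuousOn hγ).aestronglyMeasurable_unit
  have hbd : ∀ z, ‖w z‖ ≤ b := fun z => by
    rw [Real.norm_of_nonneg (ha.le.trans (hab z).1)]; exact (hab z).2
  set F : ℝ → E := fun t => (‖u t‖ ^ 2 / 2) • gradient w (pathOf x u t) with hF
  have hFi : Integrable F unitMeasure := by
    obtain ⟨L, hL⟩ := isCompact_Icc.exists_bound_of_continuousOn (hgrad.comp_continuousOn hγ)
    have hsq : Integrable (fun t => ‖u t‖ ^ 2 / 2) unitMeasure :=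
      hu2.norm.integrable_sq.div_const 2
    refine (hsq.norm.mul_const L).mono'
      (hsq.1.smul (hgrad.comp_continuousOn hγ).aestronglyMeasurable_unit) ?_
    filter_upwards [ae_restrict_mem measurableSet_Ioc] with t ht
    rw [hF, norm_smul]
    exact mul_le_mul_of_nonneg_left (hL t (Ioc_subset_Icc_self ht)) (norm_nonneg _)
  refine ⟨hFi, ?_⟩
  have hG := continuousOn_pathOf (x := (0 : E)) hFi
  set A : ℝ → E := fun t => w (pathOf x u t) • u t - pathOf 0 F t with hA
  have hwu : MemLp (fun t => w (pathOf x u t) • u t) 2 unitMeasure :=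
    hu2.of_le_mul (c := b) (hwγ.smul hu2.1) <| ae_of_all _ fun t => by
      rw [norm_smul]; exact mul_le_mul_of_nonneg_right (hbd _) (norm_nonneg _)
  have hGL : MemLp (pathOf 0 F) 2 unitMeasure := by
    obtain ⟨C, hC⟩ := isCompact_Icc.exists_bound_of_continuousOn hG
    refine MemLp.of_bound hG.aestronglyMeasurable_unit C ?_
    filter_upwards [ae_restrict_mem measurableSet_Ioc] with t ht
    exact hC t (Ioc_subset_Icc_self ht)
  have hAL : MemLp A 2 unitMeasure := hwu.sub hGL
  -- the variation: the deviation of `A` from its mean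
  set m : E := ∫ t, A t ∂unitMeasure with hm
  set v : ℝ → E := fun t => A t - m with hv
  have hvL : MemLp v 2 unitMeasure := hAL.sub (memLp_const m)
  have hvi := hvL.integrable one_le_two
  have hv0 : ∫ t, v t ∂unitMeasure = 0 := by
    rw [hv, integral_sub (hAL.integrable one_le_two) (integrable_const m), integral_const]
    simp [m]
  have hv1 : pathOf 0 v 1 = 0 := by
    rw [pathOf, zero_add, intervalIntegral.integral_of_le zero_le_one, hv0]
  obtain ⟨hint, hderiv⟩ := hasDerivAt_pathEnergy hw hab ha x hu2 hvL
  have hloc : IsLocalMin (fun ε : ℝ => pathEnergy w x (fun t => u t + ε • v t)) 0 := by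
    refine Eventually.of_forall fun ε => ?_
    simp only [zero_smul, add_zero]
    refine hmin _ ⟨hu2.add (hvL.const_smul ε), ?_⟩
    rw [pathOf_add_smul x hui hvi ε (right_mem_Icc.2 zero_le_one), hv1, smul_zero, add_zero,
      hu.target]
  have hzero := hloc.hasDerivAt_eq_zero hderiv
  have hwuv : Integrable (fun t => inner ℝ (w (pathOf x u t) • u t) (v t)) unitMeasure :=
    (L2.integrable_inner (𝕜 := ℝ) hwu.toLp hvL.toLp).congr <| by
      filter_upwards [hwu.coeFn_toLp, hvL.coeFn_toLp] with t h1 h2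
      rw [h1, h2]
  have hzero' : (∫ t, inner ℝ (F t) (pathOf 0 v t) ∂unitMeasure) +
      ∫ t, inner ℝ (w (pathOf x u t) • u t) (v t) ∂unitMeasure = 0 := by
    rw [← integral_add (integrable_inner_pathOf hFi hvi) hwuv]
    have : (fun t => fderiv ℝ w (pathOf x u t) (pathOf 0 v t) * ‖u t‖ ^ 2 +
      w (pathOf x u t) * (2 * inner ℝ (u t) (v t))) = fun t => 2 * (inner ℝ (F t) (pathOf 0 v t) +
        inner ℝ (w (pathOf x u t) • u t) (v t)) := by
      funext t
      rw [hF, real_inner_smul_left, real_inner_smul_left, inner_gradient_left]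
      ring
    rw [this, integral_const_mul] at hzero
    linarith
  have hparts := integral_inner_pathOf_add hFi hvi
  rw [hv1, inner_zero_right] at hparts
  -- after integration by parts, stationarity says that `A` is orthogonal to `v`; as `v` has mean
  -- zero, it is also orthogonal to `m`, hence to `A - m = v` itself
  have hAv : ∫ t, inner ℝ (A t) (v t) ∂unitMeasure = 0 := by
    have h1 : (fun t => inner ℝ (A t) (v t)) = fun t =>
        inner ℝ (w (pathOf x u t) • u t) (v t) - inner ℝ (v t) (pathOf 0 F t) := by
      funext t
      rw [hA, inner_sub_left, real_inner_comm (v t) (pathOf 0 F t)]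
    rw [h1, integral_sub hwuv (integrable_inner_pathOf hvi hFi)]
    linarith
  have hvv : ∫ t, ‖v t‖ ^ 2 ∂unitMeasure = 0 := by
    have h1 : (fun t => ‖v t‖ ^ 2) = fun t => inner ℝ (A t) (v t) - inner ℝ m (v t) := by
      funext t
      rw [← inner_sub_left, real_inner_self_eq_norm_sq]
    rw [h1, integral_sub, hAv, integral_inner hvi m, hv0, inner_zero_right, sub_zero]
    · refine (L2.integrable_inner (𝕜 := ℝ) hAL.toLp hvL.toLp).congr ?_
      filter_upwards [hAL.coeFn_toLp, hvL.coeFn_toLp] with t h1 h2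
      rw [h1, h2]
    · exact hvi.const_inner m
  rw [integral_eq_zero_iff_of_nonneg (fun t => sq_nonneg _) hvL.norm.integrable_sq] at hvv
  refine ⟨m, ?_⟩
  filter_upwards [hvv] with t ht
  have h1 : v t = 0 := by simpa using ht
  have h2 : w (pathOf x u t) • u t - pathOf 0 F t - m = 0 := h1
  have h3 : pathOf m F t = m + pathOf 0 F t := by simp [pathOf]
  rw [sub_sub, sub_eq_zero] at h2
  rw [h3, h2, add_comm]

end EulerLagrange

/-! ### Regularity of minimizers -/

section ContinuousVelocity

variable {E : Type*} [NormedAddCommGroup E] [InnerProductSpace ℝ E] [FiniteDimensional ℝ E]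
variable {w : E → ℝ} {a b : ℝ}

theorem hasDerivAt_pathOf (x : E) {U : ℝ → E} (hU : Continuous U) (t : ℝ) :
    HasDerivAt (pathOf x U) (U t) t :=
  (hU.integral_hasStrictDerivAt 0 t).hasDerivAt.const_add x

theorem memLp_unit_of_continuousOn {U : ℝ → E} (hU : ContinuousOn U (Icc 0 1)) :
    MemLp U 2 unitMeasure := by
  have := FiniteDimensional.proper_real E
  obtain ⟨C, hC⟩ := isCompact_Icc.exists_bound_of_continuousOn hU
  refine MemLp.of_bound hU.aestronglyMeasurable_unit C ?_
  filter_upwards [ae_restrict_mem measurableSet_Ioc] with t ht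
  exact hC t (Ioc_subset_Icc_self ht)

/-- Velocities of least energy are continuous, up to a null set. -/
theorem exists_continuous_minimal_velocity (hw : ContDiff ℝ 1 w) (hab : ∀ z, w z ∈ Icc a b)
    (ha : 0 < a) (x y : E) :
    ∃ U, Continuous U ∧ IsVelocity x y U ∧
      ∀ v, IsVelocity x y v → pathEnergy w x U ≤ pathEnergy w x v := by
  obtain ⟨u, hu, hmin⟩ := exists_minimal_velocity hw.continuous hab ha x y
  obtain ⟨hFi, c, hc⟩ := euler_lagrange hw hab ha hu hmin
  have hpos : ∀ z, 0 < w z := fun z => ha.trans_le (hab z).1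
  set F : ℝ → E := fun t => (‖u t‖ ^ 2 / 2) • gradient w (pathOf x u t)
  have hcont : ContinuousOn (fun t => (w (pathOf x u t))⁻¹ • pathOf c F t) (Icc 0 1) :=
    ((hw.continuous.comp_continuousOn
      (continuousOn_pathOf (hu.memLp.integrable one_le_two))).inv₀ fun t _ => (hpos _).ne').smul
      (continuousOn_pathOf hFi)
  set U : ℝ → E := IccExtend (zero_le_one (α := ℝ))
    ((Icc (0 : ℝ) 1).domRestrict fun t => (w (pathOf x u t))⁻¹ • pathOf c F t)
  have hU : Continuous U := hcont.domRestrict.Icc_extend'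
  have hUu : U =ᵐ[unitMeasure] u := by
    filter_upwards [hc, ae_restrict_mem measurableSet_Ioc] with t ht htI
    calc U t = (w (pathOf x u t))⁻¹ • pathOf c F t :=
          IccExtend_of_mem _ _ (Ioc_subset_Icc_self htI)
      _ = u t := by rw [← ht, inv_smul_smul₀ (hpos _).ne']
  refine ⟨U, hU, ⟨(memLp_congr_ae hUu).2 hu.memLp, ?_⟩, fun v hv => ?_⟩
  · rw [pathOf_congr_ae hUu (right_mem_Icc.2 zero_le_one), hu.target]
  · rw [pathEnergy_congr_ae hUu]; exact hmin v hv

end ContinuousVelocity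

/-! ### The conformal distance -/

section ConformalDistance

variable {d : ℕ} {κ : EuclideanSpace ℝ (Fin d) → ℝ} {m M : ℝ}

theorem continuousOn_derivWithin_path {x y : EuclideanSpace ℝ (Fin d)}
    {γ : ℝ → EuclideanSpace ℝ (Fin d)} (hγ : IsC1Path x y γ) :
    ContinuousOn (derivWithin γ (Icc 0 1)) (Icc 0 1) :=
  hγ.contDiffOn.continuousOn_derivWithin (uniqueDiffOn_Icc zero_lt_one) le_rfl

theorem hasDerivWithinAt_path {x y : EuclideanSpace ℝ (Fin d)}
    {γ : ℝ → EuclideanSpace ℝ (Fin d)} (hγ : IsC1Path x y γ) {t : ℝ} (ht : t ∈ Icc (0 : ℝ) 1) :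
    HasDerivWithinAt γ (derivWithin γ (Icc 0 1) t) (Icc 0 1) t :=
  (hγ.contDiffOn.differentiableOn one_ne_zero t ht).hasDerivWithinAt

theorem pathOf_derivWithin {x y : EuclideanSpace ℝ (Fin d)}
    {γ : ℝ → EuclideanSpace ℝ (Fin d)} (hγ : IsC1Path x y γ) {t : ℝ} (ht : t ∈ Icc (0 : ℝ) 1) :
    pathOf x (derivWithin γ (Icc 0 1)) t = γ t := by
  have h := intervalIntegral.integral_eq_sub_of_hasDerivAt_of_le (f := γ)
    (f' := derivWithin γ (Icc 0 1)) ht.1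
    (hγ.contDiffOn.continuousOn.mono (Icc_subset_Icc_right ht.2))
    (fun s hs => (hasDerivWithinAt_path hγ ⟨hs.1.le, hs.2.le.trans ht.2⟩).hasDerivAt
      (Icc_mem_nhds hs.1 (hs.2.trans_le ht.2)))
    (intervalIntegrable_of_unit
      ((memLp_unit_of_continuousOn (continuousOn_derivWithin_path hγ)).integrable one_le_two)
      (left_mem_Icc.2 zero_le_one) ht)
  rw [pathOf, h, hγ.source, add_sub_cancel]

theorem isVelocity_derivWithin {x y : EuclideanSpace ℝ (Fin d)}
    {γ : ℝ → EuclideanSpace ℝ (Fin d)} (hγ : IsC1Path x y γ) :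
    IsVelocity x y (derivWithin γ (Icc 0 1)) :=
  ⟨memLp_unit_of_continuousOn (continuousOn_derivWithin_path hγ), by
    rw [pathOf_derivWithin hγ (right_mem_Icc.2 zero_le_one), hγ.target]⟩

/-- For `C¹` paths the two energies agree; `derivWithin` is the velocity, also at the end points. -/
theorem conformalEnergy_eq_pathEnergy {x y : EuclideanSpace ℝ (Fin d)}
    {γ : ℝ → EuclideanSpace ℝ (Fin d)} (hγ : IsC1Path x y γ) :
    conformalEnergy κ γ = pathEnergy (fun z => 1 / κ z) x (derivWithin γ (Icc 0 1)) := by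
  rw [conformalEnergy, intervalIntegral.integral_of_le zero_le_one, pathEnergy]
  refine integral_congr_ae ?_
  filter_upwards [ae_restrict_mem measurableSet_Ioc] with t ht
  rw [pathOf_derivWithin hγ (Ioc_subset_Icc_self ht)]

theorem isC1Path_pathOf {x y : EuclideanSpace ℝ (Fin d)} {U : ℝ → EuclideanSpace ℝ (Fin d)}
    (hU : Continuous U) (h : IsVelocity x y U) : IsC1Path x y (pathOf x U) := by
  refine ⟨ContDiff.contDiffOn ?_, pathOf_zero x U, h.target⟩
  rw [contDiff_one_iff_deriv]
  refine ⟨fun t => (hasDerivAt_pathOf x hU t).differentiableAt, ?_⟩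
  rw [show deriv (pathOf x U) = U from funext fun t => (hasDerivAt_pathOf x hU t).deriv]
  exact hU

theorem conformalEnergy_pathOf {x y : EuclideanSpace ℝ (Fin d)} {U : ℝ → EuclideanSpace ℝ (Fin d)}
    (hU : Continuous U) (h : IsVelocity x y U) :
    conformalEnergy κ (pathOf x U) = pathEnergy (fun z => 1 / κ z) x U := by
  rw [conformalEnergy_eq_pathEnergy (isC1Path_pathOf hU h)]
  refine pathEnergy_congr_ae ?_
  filter_upwards [ae_restrict_mem measurableSet_Ioc] with t ht
  exact (hasDerivAt_pathOf x hU t).hasDerivWithinAt.derivWithin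
    (uniqueDiffOn_Icc zero_lt_one t (Ioc_subset_Icc_self ht))

theorem one_div_mem_Icc (hm : 0 < m) (hκ : ∀ z, κ z ∈ Icc m M) (z : EuclideanSpace ℝ (Fin d)) :
    1 / κ z ∈ Icc (1 / M) (1 / m) :=
  ⟨one_div_le_one_div_of_le (hm.trans_le (hκ z).1) (hκ z).2, one_div_le_one_div_of_le hm (hκ z).1⟩

theorem conformalDist_nonneg (x y : EuclideanSpace ℝ (Fin d)) : 0 ≤ conformalDist κ x y :=
  Real.sInf_nonneg (by rintro _ ⟨γ, -, rfl⟩; exact Real.sqrt_nonneg _)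

/-- The infimum defining the conformal distance is attained by a `C¹` path, and it bounds the
energy of all paths with square-integrable velocity. -/
theorem exists_conformalDist_sq_eq (hm : 0 < m) (hκ : ∀ z, κ z ∈ Icc m M) (hC : ContDiff ℝ 1 κ)
    (x y : EuclideanSpace ℝ (Fin d)) :
    ∃ U, Continuous U ∧ IsVelocity x y U ∧
      conformalDist κ x y ^ 2 = pathEnergy (fun z => 1 / κ z) x U ∧
      ∀ v, IsVelocity x y v → conformalDist κ x y ^ 2 ≤ pathEnergy (fun z => 1 / κ z) x v := by
  have hpos : ∀ z, 0 < κ z := fun z => hm.trans_le (hκ z).1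
  have hM : 0 < 1 / M := one_div_pos.2 (hm.trans_le ((hκ 0).1.trans (hκ 0).2))
  have hw : ContDiff ℝ 1 fun z => 1 / κ z := contDiff_const.div hC fun z => (hpos z).ne'
  obtain ⟨U, hU, hv, hmin⟩ := exists_continuous_minimal_velocity hw (one_div_mem_Icc hm hκ) hM x y
  have hE0 : 0 ≤ pathEnergy (fun z => 1 / κ z) x U :=
    pathEnergy_nonneg (fun z => (one_div_pos.2 (hpos z)).le) x U
  have key : conformalDist κ x y = Real.sqrt (pathEnergy (fun z => 1 / κ z) x U) := by
    refine IsLeast.csInf_eq ⟨⟨pathOf x U, isC1Path_pathOf hU hv, ?_⟩, ?_⟩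
    · rw [conformalEnergy_pathOf hU hv]
    · rintro _ ⟨γ, hγ, rfl⟩
      rw [conformalEnergy_eq_pathEnergy hγ]
      exact Real.sqrt_le_sqrt (hmin _ (isVelocity_derivWithin hγ))
  have hsq : conformalDist κ x y ^ 2 = pathEnergy (fun z => 1 / κ z) x U := by
    rw [key, Real.sq_sqrt hE0]
  exact ⟨U, hU, hv, hsq, fun v hv' => hsq.le.trans (hmin v hv')⟩

theorem eq_of_pathEnergy_eq_zero {w : EuclideanSpace ℝ (Fin d) → ℝ}
    (hw : ∀ z, 0 < w z) {x y : EuclideanSpace ℝ (Fin d)}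
    {U : ℝ → EuclideanSpace ℝ (Fin d)} (hv : IsVelocity x y U)
    (hint : Integrable (fun t => w (pathOf x U t) * ‖U t‖ ^ 2) unitMeasure)
    (h : pathEnergy w x U = 0) : x = y := by
  rw [pathEnergy, integral_eq_zero_iff_of_nonneg
    (fun t => mul_nonneg (hw _).le (sq_nonneg _)) hint] at h
  have hU : U =ᵐ[unitMeasure] fun _ => 0 := by
    filter_upwards [h] with t ht
    rcases mul_eq_zero.1 ht with h | h
    · exact absurd h (hw _).ne'
    · simpa using h
  rw [← hv.target, pathOf_congr_ae hU (right_mem_Icc.2 zero_le_one)]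
  simp [pathOf]

/-- Time reversal of an optimal path. -/
theorem conformalDist_symm_le (hm : 0 < m) (hκ : ∀ z, κ z ∈ Icc m M) (hC : ContDiff ℝ 1 κ)
    (x y : EuclideanSpace ℝ (Fin d)) : conformalDist κ x y ≤ conformalDist κ y x := by
  obtain ⟨U, hU, hv, hE, -⟩ := exists_conformalDist_sq_eq hm hκ hC y x
  obtain ⟨-, -, -, -, hle⟩ := exists_conformalDist_sq_eq hm hκ hC x y
  refine le_of_sq_le_sq ?_ (conformalDist_nonneg _ _)
  set V : ℝ → EuclideanSpace ℝ (Fin d) := fun t => -U (1 - t) with hVdef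
  have hV : Continuous V := (hU.comp (continuous_const.sub continuous_id)).neg
  have hpath : ∀ t, pathOf x V t = pathOf y U (1 - t) := by
    intro t
    have h1 : ∫ s in (0 : ℝ)..t, V s = -∫ s in (1 - t)..1, U s := by
      rw [hVdef, intervalIntegral.integral_neg, intervalIntegral.integral_comp_sub_left U 1,
        sub_zero]
    have h2 := intervalIntegral.integral_add_adjacent_intervals
      (hU.intervalIntegrable (μ := volume) 0 (1 - t)) (hU.intervalIntegrable (1 - t) 1)
    have h3 := hv.target
    rw [pathOf] at h3
    rw [pathOf, pathOf, h1, ← h3, ← h2]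
    abel
  have hvV : IsVelocity x y V := ⟨memLp_unit_of_continuousOn hV.continuousOn, by
    rw [hpath, sub_self, pathOf_zero]⟩
  refine (hle V hvV).trans (le_of_eq ?_)
  rw [hE, pathEnergy, pathEnergy, ← intervalIntegral.integral_of_le zero_le_one,
    ← intervalIntegral.integral_of_le zero_le_one]
  have := intervalIntegral.integral_comp_sub_left (a := 0) (b := 1)
    (fun t => 1 / κ (pathOf y U t) * ‖U t‖ ^ 2) 1
  rw [sub_self, sub_zero] at this
  rw [← this]
  refine intervalIntegral.integral_congr fun t _ => ?_
  simp only [hpath]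
  simp only [hVdef, norm_neg]

/-- Concatenation of two paths, run on `[0, l]` and `[l, 1]`. -/
theorem conformalDist_sq_le_concat (hm : 0 < m) (hκ : ∀ z, κ z ∈ Icc m M) (hC : ContDiff ℝ 1 κ)
    {x y z : EuclideanSpace ℝ (Fin d)} {l : ℝ} (hl : 0 < l) (hl1 : l < 1) :
    conformalDist κ x z ^ 2 ≤
      l⁻¹ * conformalDist κ x y ^ 2 + (1 - l)⁻¹ * conformalDist κ y z ^ 2 := by
  obtain ⟨U₁, hU₁, hv₁, hE₁, -⟩ := exists_conformalDist_sq_eq hm hκ hC x y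
  obtain ⟨U₂, hU₂, hv₂, hE₂, -⟩ := exists_conformalDist_sq_eq hm hκ hC y z
  obtain ⟨-, -, -, -, hle⟩ := exists_conformalDist_sq_eq hm hκ hC x z
  have hl' : 0 < 1 - l := sub_pos.2 hl1
  set q : ℝ := (1 - l)⁻¹ with hq
  have h0I : (0 : ℝ) ∈ Icc (0 : ℝ) 1 := left_mem_Icc.2 zero_le_one
  have h1I : (1 : ℝ) ∈ Icc (0 : ℝ) 1 := right_mem_Icc.2 zero_le_one
  have hlI : l ∈ Icc (0 : ℝ) 1 := ⟨hl.le, hl1.le⟩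
  -- the concatenated path has velocity `V₁` before and `V₂` after the time `l`, in general with a
  -- jump, so that it need not be `C¹`
  set V₁ : ℝ → EuclideanSpace ℝ (Fin d) := fun t => l⁻¹ • U₁ (l⁻¹ * t) with hV₁
  set V₂ : ℝ → EuclideanSpace ℝ (Fin d) := fun t => q • U₂ (q * t - q * l) with hV₂
  have hc₁ : Continuous V₁ := by fun_prop
  have hc₂ : Continuous V₂ := by fun_prop
  set V : ℝ → EuclideanSpace ℝ (Fin d) := fun t => if t ≤ l then V₁ t else V₂ t with hV
  have hVL : MemLp V 2 unitMeasure := by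
    obtain ⟨C₁, hC₁⟩ := isCompact_Icc.exists_bound_of_continuousOn
      (hc₁.continuousOn (s := Icc (0 : ℝ) 1))
    obtain ⟨C₂, hC₂⟩ := isCompact_Icc.exists_bound_of_continuousOn
      (hc₂.continuousOn (s := Icc (0 : ℝ) 1))
    refine MemLp.of_bound (StronglyMeasurable.ite measurableSet_Iic hc₁.stronglyMeasurable
      hc₂.stronglyMeasurable).aestronglyMeasurable (max C₁ C₂) ?_
    filter_upwards [ae_restrict_mem measurableSet_Ioc] with t ht
    have ht := Ioc_subset_Icc_self ht
    by_cases h : t ≤ l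
    · simp only [hV, if_pos h]; exact (hC₁ t ht).trans (le_max_left _ _)
    · simp only [hV, if_neg h]; exact (hC₂ t ht).trans (le_max_right _ _)
  have hVi := hVL.integrable one_le_two
  have hpath₁ : ∀ t ∈ Icc 0 l, pathOf x V t = pathOf x U₁ (l⁻¹ * t) := by
    intro t ht
    have h1 : ∫ s in (0 : ℝ)..t, V s = ∫ s in (0 : ℝ)..t, V₁ s := by
      refine intervalIntegral.integral_congr fun s hs => ?_
      rw [uIcc_of_le ht.1] at hs
      exact if_pos (hs.2.trans ht.2)
    rw [pathOf, pathOf, h1, hV₁, intervalIntegral.integral_smul,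
      intervalIntegral.smul_integral_comp_mul_left, mul_zero]
  have hpathl : pathOf x V l = y := by
    rw [hpath₁ l (right_mem_Icc.2 hl.le), inv_mul_cancel₀ hl.ne', hv₁.target]
  have hpath₂ : ∀ t ∈ Icc l 1, pathOf x V t = pathOf y U₂ (q * t - q * l) := by
    intro t ht
    have h1 : ∫ s in l..t, V s = ∫ s in l..t, V₂ s := by
      refine intervalIntegral.integral_congr_ae (ae_of_all _ fun s hs => ?_)
      rw [uIoc_of_le ht.1] at hs
      exact if_neg hs.1.not_ge
    have h2 := intervalIntegral.integral_add_adjacent_intervals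
      (intervalIntegrable_of_unit hVi h0I hlI)
      (intervalIntegrable_of_unit hVi hlI ⟨hl.le.trans ht.1, ht.2⟩)
    rw [← hpathl, pathOf, pathOf, pathOf, ← h2, h1, hV₂, intervalIntegral.integral_smul,
      intervalIntegral.smul_integral_comp_mul_sub, sub_self, add_assoc]
  have hq1 : q * 1 - q * l = 1 := by rw [← mul_sub, inv_mul_cancel₀ hl'.ne']
  have hvV : IsVelocity x z V :=
    ⟨hVL, by rw [hpath₂ 1 ⟨hl1.le, le_rfl⟩, hq1, hv₂.target]⟩
  refine (hle V hvV).trans (le_of_eq ?_)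
  have hpos : ∀ z, 0 < κ z := fun z => hm.trans_le (hκ z).1
  have hw : Continuous fun z => 1 / κ z :=
    continuous_const.div hC.continuous fun z => (hpos z).ne'
  have hint := integrable_pathEnergy hw (one_div_mem_Icc hm hκ) (x := x) hVL
  have hE : ∀ {p : EuclideanSpace ℝ (Fin d)} {U : ℝ → EuclideanSpace ℝ (Fin d)},
      pathEnergy (fun z => 1 / κ z) p U = ∫ t in (0 : ℝ)..1, 1 / κ (pathOf p U t) * ‖U t‖ ^ 2 :=
    fun {p U} => (intervalIntegral.integral_of_le zero_le_one).symm
  rw [hE₁, hE₂, hE, hE, hE, ← intervalIntegral.integral_add_adjacent_intervals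
    (intervalIntegrable_of_unit hint h0I hlI) (intervalIntegrable_of_unit hint hlI h1I)]
  congr 1
  · have h1 := intervalIntegral.smul_integral_comp_mul_left (a := 0) (b := l)
      (fun t => 1 / κ (pathOf x U₁ t) * ‖U₁ t‖ ^ 2) l⁻¹
    rw [mul_zero, inv_mul_cancel₀ hl.ne', smul_eq_mul] at h1
    rw [← h1, ← mul_assoc, ← intervalIntegral.integral_const_mul]
    refine intervalIntegral.integral_congr fun t ht => ?_
    rw [uIcc_of_le hl.le] at ht
    have h2 : V t = l⁻¹ • U₁ (l⁻¹ * t) := if_pos ht.2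
    simp only [hpath₁ t ht, h2, norm_smul, Real.norm_of_nonneg (inv_pos.2 hl).le]
    ring
  · have h1 := intervalIntegral.smul_integral_comp_mul_sub (a := l) (b := 1)
      (fun t => 1 / κ (pathOf y U₂ t) * ‖U₂ t‖ ^ 2) q (q * l)
    rw [sub_self, hq1, smul_eq_mul] at h1
    rw [← h1, ← mul_assoc, ← intervalIntegral.integral_const_mul]
    refine intervalIntegral.integral_congr_ae (ae_of_all _ fun t ht => ?_)
    rw [uIoc_of_le hl1.le] at ht
    have h2 : V t = q • U₂ (q * t - q * l) := if_neg ht.1.not_ge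
    simp only [hpath₂ t (Ioc_subset_Icc_self ht), h2, norm_smul,
      Real.norm_of_nonneg (inv_pos.2 hl').le, hq]
    ring

theorem isDistance_conformalDist (hm : 0 < m) (hκ : ∀ z, κ z ∈ Icc m M) (hC : ContDiff ℝ 1 κ) :
    IsDistance (conformalDist κ) := by
  have hpos : ∀ z, 0 < 1 / κ z := fun z => one_div_pos.2 (hm.trans_le (hκ z).1)
  have hw : Continuous fun z => 1 / κ z :=
    continuous_const.div hC.continuous fun z => (hm.trans_le (hκ z).1).ne'
  have hself : ∀ x, conformalDist κ x x = 0 := by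
    intro x
    obtain ⟨-, -, -, -, hle⟩ := exists_conformalDist_sq_eq hm hκ hC x x
    have := hle (fun _ => 0) ⟨memLp_const _, by simp [pathOf]⟩
    simpa [pathEnergy, sq_nonpos_iff] using this
  have heq : ∀ x y, conformalDist κ x y = 0 → x = y := by
    intro x y h
    obtain ⟨U, hU, hv, hE, -⟩ := exists_conformalDist_sq_eq hm hκ hC x y
    refine eq_of_pathEnergy_eq_zero hpos hv
      (integrable_pathEnergy hw (one_div_mem_Icc hm hκ) hv.memLp) ?_
    rw [← hE, h, zero_pow two_ne_zero]
  refine ⟨conformalDist_nonneg, fun x y => ⟨heq x y, ?_⟩, fun x y =>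
    (conformalDist_symm_le hm hκ hC x y).antisymm (conformalDist_symm_le hm hκ hC y x), ?_⟩
  · rintro rfl; exact hself x
  · intro x y z
    rcases (conformalDist_nonneg (κ := κ) x y).eq_or_lt with h1 | h1
    · rw [heq x y h1.symm, hself, zero_add]
    rcases (conformalDist_nonneg (κ := κ) y z).eq_or_lt with h2 | h2
    · rw [heq y z h2.symm, hself, add_zero]
    -- the optimal division of time is proportional to the lengths of the two pieces
    set p := conformalDist κ x y
    set q := conformalDist κ y z
    have hpq : 0 < p + q := add_pos h1 h2
    have h := conformalDist_sq_le_concat hm hκ hC (x := x) (y := y) (z := z)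
      (l := p / (p + q)) (div_pos h1 hpq) ((div_lt_one hpq).2 (by linarith))
    refine le_of_sq_le_sq (h.trans (le_of_eq ?_)) hpq.le
    have h3 : 1 - p / (p + q) = q / (p + q) := by field_simp; ring
    rw [h3]
    change (p / (p + q))⁻¹ * p ^ 2 + (q / (p + q))⁻¹ * q ^ 2 = (p + q) ^ 2
    field_simp

end ConformalDistance

/-! ### The maximum principle along geodesics -/

section Barrier

/-- The fundamental theorem of calculus for integrands continuous on `[0, 1]` only. -/
theorem hasDerivAt_pathOf_of_continuousOn {E : Type*} [NormedAddCommGroup E]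
    [InnerProductSpace ℝ E] [FiniteDimensional ℝ E] (x : E) {F : ℝ → E}
    (hF : ContinuousOn F (Icc 0 1)) {t : ℝ} (ht : t ∈ Ioo (0 : ℝ) 1) :
    HasDerivAt (pathOf x F) (F t) t := by
  have := FiniteDimensional.proper_real E
  refine (intervalIntegral.integral_hasDerivAt_right
    (intervalIntegrable_of_unit ((memLp_unit_of_continuousOn hF).integrable one_le_two)
      (left_mem_Icc.2 zero_le_one) (Ioo_subset_Icc_self ht)) ?_
    (hF.continuousAt (Icc_mem_nhds ht.1 ht.2))).const_add x
  exact (hF.mono Ioo_subset_Icc_self).stronglyMeasurableAtFilter isOpen_Ioo t ht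

theorem HasDerivAt.eventually_pos_of_pos {m : ℝ → ℝ} {m' t : ℝ} (h : HasDerivAt m m' t)
    (hm : m t = 0) (hm' : 0 < m') : ∀ᶠ s in 𝓝[>] t, 0 < m s := by
  have h1 := (hasDerivAt_iff_tendsto_slope.1 h).mono_left
    (show 𝓝[>] t ≤ 𝓝[≠] t from nhdsWithin_mono t fun s hs => ne_of_gt hs)
  filter_upwards [h1.eventually_const_lt hm', self_mem_nhdsWithin] with s hs hts
  rw [slope_def_field, hm, sub_zero] at hs
  exact (div_pos_iff_of_pos_right (sub_pos.2 hts)).1 hs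

variable {d : ℕ} {κ : EuclideanSpace ℝ (Fin d) → ℝ} {m M : ℝ}

/-- The momentum equation `(γ'/κ)' = ½ |γ'|² ∇(1/κ)` of a minimizing geodesic. -/
theorem IsMinimizingGeodesic.exists_momentum (hm : 0 < m) (hκ : ∀ z, κ z ∈ Icc m M)
    (hC : ContDiff ℝ 1 κ) {x y : EuclideanSpace ℝ (Fin d)} {γ : ℝ → EuclideanSpace ℝ (Fin d)}
    (h : IsMinimizingGeodesic κ x y γ) :
    ∃ P : ℝ → EuclideanSpace ℝ (Fin d),
      (∀ t ∈ Icc (0 : ℝ) 1, derivWithin γ (Icc 0 1) t = κ (γ t) • P t) ∧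
      ∀ t ∈ Ioo (0 : ℝ) 1, HasDerivAt P
        ((‖derivWithin γ (Icc 0 1) t‖ ^ 2 / 2) • gradient (fun z => 1 / κ z) (γ t)) t := by
  have hγ := h.1
  have hpos : ∀ z, 0 < κ z := fun z => hm.trans_le (hκ z).1
  have hM : 0 < 1 / M := one_div_pos.2 (hm.trans_le ((hκ 0).1.trans (hκ 0).2))
  have hw : ContDiff ℝ 1 fun z => 1 / κ z := contDiff_const.div hC fun z => (hpos z).ne'
  set u := derivWithin γ (Icc 0 1) with hu
  have huc : ContinuousOn u (Icc 0 1) := continuousOn_derivWithin_path hγ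
  obtain ⟨-, -, -, -, hle⟩ := exists_conformalDist_sq_eq hm hκ hC x y
  obtain ⟨hFi, c, hc⟩ := euler_lagrange hw (one_div_mem_Icc hm hκ) hM
    (isVelocity_derivWithin hγ) fun v hv => by
      rw [← conformalEnergy_eq_pathEnergy hγ, ← h.2]; exact hle v hv
  set F : ℝ → EuclideanSpace ℝ (Fin d) :=
    fun s => (‖u s‖ ^ 2 / 2) • gradient (fun z => 1 / κ z) (γ s) with hF
  have hgrad : Continuous (gradient fun z => 1 / κ z) :=
    (InnerProductSpace.toDual ℝ _).symm.continuous.comp (hw.continuous_fderiv one_ne_zero)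
  have hFc : ContinuousOn F (Icc 0 1) :=
    ((huc.norm.pow 2).div_const 2).smul (hgrad.comp_continuousOn hγ.contDiffOn.continuousOn)
  have hcongr : ∀ t ∈ Icc (0 : ℝ) 1, pathOf c (fun s => (‖u s‖ ^ 2 / 2) •
      gradient (fun z => 1 / κ z) (pathOf x u s)) t = pathOf c F t := fun t ht => by
    refine pathOf_congr_ae ?_ ht
    filter_upwards [ae_restrict_mem measurableSet_Ioc] with s hs
    rw [pathOf_derivWithin hγ (Ioc_subset_Icc_self hs)]
  have hPc : ContinuousOn (pathOf c F) (Icc 0 1) :=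
    continuousOn_pathOf ((memLp_unit_of_continuousOn hFc).integrable one_le_two)
  have hae : (fun t => (1 / κ (γ t)) • u t) =ᵐ[volume.restrict (Icc 0 1)] pathOf c F := by
    rw [← restrict_Ioc_eq_restrict_Icc]
    filter_upwards [hc, ae_restrict_mem measurableSet_Ioc] with t ht htI
    rw [← hcongr t (Ioc_subset_Icc_self htI), ← ht,
      pathOf_derivWithin hγ (Ioc_subset_Icc_self htI)]
  have heq := Measure.eqOn_Icc_of_ae_eq volume zero_ne_one hae
    ((hw.continuous.comp_continuousOn hγ.contDiffOn.continuousOn).smul huc) hPc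
  refine ⟨pathOf c F, fun t ht => ?_, fun t ht => hasDerivAt_pathOf_of_continuousOn c hFc ht⟩
  rw [← heq ht, smul_smul, mul_one_div_cancel (hpos _).ne', one_smul]

/-- Where `κ` does not increase in the direction `n`, its inverse does not decrease. -/
theorem inner_gradient_one_div_nonneg (hpos : ∀ z, 0 < κ z)
    (hC : ContDiff ℝ 1 κ) {z n : EuclideanSpace ℝ (Fin d)} (h : fderiv ℝ κ z n ≤ 0) :
    0 ≤ inner ℝ n (gradient (fun z => 1 / κ z) z) := by
  have h1 : HasFDerivAt (fun z => 1 / κ z) (-(κ z ^ 2)⁻¹ • fderiv ℝ κ z) z := by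
    simp_rw [one_div]
    exact (hasDerivAt_inv (hpos z).ne').comp_hasFDerivAt z
      (hC.differentiable one_ne_zero z).hasFDerivAt
  rw [real_inner_comm, inner_gradient_left, h1.fderiv, smul_apply, smul_eq_mul]
  exact mul_nonneg_of_nonpos_of_nonpos (neg_nonpos.2 (inv_nonneg.2 (sq_nonneg _))) h

/-- Maximum principle for geodesics. Let `Ω = {H < 0}` and suppose that near and outside `Ω`
the function `H` has at each point a subgradient `n` along which `κ` does not increase. Along a
geodesic `γ` the supporting affine functions then satisfy `(⟨n, γ⟩' / κ(γ))' ≥ 0`, so that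
`H ∘ γ` has no interior maximum which is nonnegative. -/
theorem isGeodesicallyConvex_of_subgradient (hm : 0 < m) (hκ : ∀ z, κ z ∈ Icc m M)
    (hC : ContDiff ℝ 1 κ) {Ω : Set (EuclideanSpace ℝ (Fin d))}
    {H : EuclideanSpace ℝ (Fin d) → ℝ} (hH : Continuous H) (hΩ : ∀ x, x ∈ Ω ↔ H x < 0) {l : ℝ}
    (hl : 0 < l) (hsub : ∀ x, -l < H x →
      ∃ n, (∀ x', H x + inner ℝ n (x' - x) ≤ H x') ∧ fderiv ℝ κ x n ≤ 0) :
    IsGeodesicallyConvex κ Ω := by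
  intro x hx y hy
  refine ⟨?_, fun γ hγmin t₀ ht₀ => ?_⟩
  · obtain ⟨U, hU, hv, hE, -⟩ := exists_conformalDist_sq_eq hm hκ hC x y
    exact ⟨pathOf x U, isC1Path_pathOf hU hv, by rw [hE, conformalEnergy_pathOf hU hv]⟩
  have hpos : ∀ z, 0 < κ z := fun z => hm.trans_le (hκ z).1
  obtain ⟨P, hP, hP'⟩ := hγmin.exists_momentum hm hκ hC
  have hγ := hγmin.1
  have hγc := hγ.contDiffOn.continuousOn
  by_contra hout
  rw [hΩ, not_lt] at hout
  rw [hΩ] at hx hy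
  -- the perturbation `g = ∫ κ(γ) t` makes the convexity strict
  set g : ℝ → ℝ := pathOf 0 fun t => κ (γ t) * t with hg
  have hgi : ContinuousOn (fun t => κ (γ t) * t) (Icc 0 1) :=
    (hC.continuous.comp_continuousOn hγc).mul continuousOn_id
  have hgc : ContinuousOn g (Icc 0 1) :=
    continuousOn_pathOf ((memLp_unit_of_continuousOn hgi).integrable one_le_two)
  have hg0 : ∀ t ∈ Icc (0 : ℝ) 1, 0 ≤ g t := fun t ht => by
    rw [hg, pathOf, zero_add]
    exact intervalIntegral.integral_nonneg ht.1 fun s hs => mul_nonneg (hpos _).le hs.1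
  obtain ⟨G, hG⟩ := isCompact_Icc.exists_bound_of_continuousOn hgc
  have hG0 : 0 ≤ G := (norm_nonneg _).trans (hG t₀ ht₀)
  set r := min l (-H y) with hr
  have hr0 : 0 < r := lt_min hl (neg_pos.2 hy)
  set ε := r / (G + 1) with hε
  have hε0 : 0 < ε := by positivity
  have hεg : ∀ t ∈ Icc (0 : ℝ) 1, ε * g t < r := fun t ht =>
    calc ε * g t ≤ ε * G := by gcongr; exact (le_abs_self _).trans (hG t ht)
      _ < ε * (G + 1) := by gcongr; linarith
      _ = r := div_mul_cancel₀ _ (by positivity)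
  have hfc : ContinuousOn (fun t => H (γ t) + ε * g t) (Icc 0 1) :=
    (hH.comp_continuousOn hγc).add (continuousOn_const.mul hgc)
  obtain ⟨t, htI, hmax⟩ := isCompact_Icc.exists_isMaxOn ⟨t₀, ht₀⟩ hfc
  have hft : 0 ≤ H (γ t) + ε * g t :=
    le_trans (add_nonneg hout (mul_nonneg hε0.le (hg0 t₀ ht₀))) (hmax ht₀)
  have ht : t ∈ Ioo (0 : ℝ) 1 := by
    refine ⟨lt_of_le_of_ne htI.1 ?_, lt_of_le_of_ne htI.2 ?_⟩
    · rintro rfl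
      rw [hγ.source, hg, pathOf_zero] at hft
      linarith
    · rintro rfl
      have h1 := (hεg 1 htI).trans_le (min_le_right _ _)
      rw [hγ.target] at hft
      linarith
  obtain ⟨n, hn, hκn⟩ := hsub (γ t) (by
    have h1 := (hεg t htI).trans_le (min_le_left _ _)
    linarith)
  -- the supporting affine function at the maximum point also has a maximum at `t` along `γ`
  set k : ℝ → ℝ := fun s => inner ℝ n (γ s - γ t) + ε * (g s - g t) with hk
  have hkle : ∀ s ∈ Icc (0 : ℝ) 1, k s ≤ 0 := fun s hs => by
    have h1 : H (γ s) + ε * g s ≤ H (γ t) + ε * g t := hmax hs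
    have h2 := hn (γ s)
    simp only [hk]
    linarith
  have hkt : k t = 0 := by simp [hk]
  have hk' : ∀ s ∈ Ioo (0 : ℝ) 1, HasDerivAt k (κ (γ s) * (inner ℝ n (P s) + ε * s)) s := by
    intro s hs
    have h1 : HasDerivAt γ (κ (γ s) • P s) s := by
      rw [← hP s (Ioo_subset_Icc_self hs)]
      exact (hasDerivWithinAt_path hγ (Ioo_subset_Icc_self hs)).hasDerivAt
        (Icc_mem_nhds hs.1 hs.2)
    have h2 := ((innerSL ℝ n).hasFDerivAt.comp_hasDerivAt s (h1.sub_const (γ t))).add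
      (((hasDerivAt_pathOf_of_continuousOn 0 hgi hs).sub_const (g t)).const_mul ε)
    convert! h2 using 1
    simp only [innerSL_apply_apply, inner_smul_right]
    ring
  have hmt : inner ℝ n (P t) + ε * t = 0 := by
    have hloc : IsLocalMax k t := by
      filter_upwards [Icc_mem_nhds ht.1 ht.2] with s hs
      rw [hkt]; exact hkle s hs
    exact (mul_eq_zero.1 (hloc.hasDerivAt_eq_zero (hk' t ht))).resolve_left (hpos _).ne'
  have hm' : HasDerivAt (fun s => inner ℝ n (P s) + ε * s)
      (inner ℝ n ((‖derivWithin γ (Icc 0 1) t‖ ^ 2 / 2) • gradient (fun z => 1 / κ z) (γ t)) +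
        ε * 1) t :=
    ((innerSL ℝ n).hasFDerivAt.comp_hasDerivAt t (hP' t ht)).add ((hasDerivAt_id t).const_mul ε)
  -- so `k'` is positive right after `t`, and `k` exceeds its maximal value `k t = 0` there
  have hm0 := hm'.eventually_pos_of_pos hmt (by
    rw [inner_smul_right, mul_one]
    exact add_pos_of_nonneg_of_pos
      (mul_nonneg (by positivity) (inner_gradient_one_div_nonneg hpos hC hκn)) hε0)
  obtain ⟨b, htb, hb⟩ := (mem_nhdsGT_iff_exists_Ioo_subset' ht.2).1
    (inter_mem hm0 (Ioo_mem_nhdsGT ht.2))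
  have hmono : StrictMonoOn k (Ico t b) := by
    refine strictMonoOn_of_deriv_pos (convex_Ico t b) (fun s hs => ?_) fun s hs => ?_
    · rcases hs.1.eq_or_lt with rfl | h
      · exact (hk' _ ht).continuousAt.continuousWithinAt
      · exact (hk' s ⟨ht.1.trans h, (hb ⟨h, hs.2⟩).2.2⟩).continuousAt.continuousWithinAt
    · rw [interior_Ico] at hs
      rw [(hk' s ⟨ht.1.trans hs.1, (hb hs).2.2⟩).deriv]
      exact mul_pos (hpos _) (hb hs).1
  obtain ⟨s, hts, hsb⟩ := exists_between (mem_Ioi.1 htb)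
  have h1 := hmono ⟨le_rfl, htb⟩ ⟨hts.le, hsb⟩ hts
  have h2 := hkle s ⟨ht.1.le.trans hts.le, (hb ⟨hts, hsb⟩).2.2.le⟩
  linarith

end Barrier

/-! ### The gauge of a convex set with `C²` boundary -/

section RadialGauge

theorem HasDerivAt.nonpos_of_eventually_le {f : ℝ → ℝ} {f' t : ℝ} (h : HasDerivAt f f' t)
    (hle : ∀ᶠ s in 𝓝[>] t, f s ≤ f t) : f' ≤ 0 := by
  have h1 := (hasDerivAt_iff_tendsto_slope.1 h).mono_left
    (show 𝓝[>] t ≤ 𝓝[≠] t from nhdsWithin_mono t fun s hs => ne_of_gt hs)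
  refine le_of_tendsto h1 ?_
  filter_upwards [hle, self_mem_nhdsWithin] with s hs hts
  rw [slope_def_field]
  exact div_nonpos_of_nonpos_of_nonneg (sub_nonpos.2 hs) (sub_nonneg.2 (le_of_lt hts))

/-- Upper bounds for difference quotients bound the directional derivative. -/
theorem HasFDerivAt.apply_le_of_eventually_le {E : Type*} [NormedAddCommGroup E]
    [NormedSpace ℝ E] {f : E → ℝ} {L : E →L[ℝ] ℝ} {x : E} (h : HasFDerivAt f L x) {v : E} {c : ℝ}
    (hle : ∀ᶠ t : ℝ in 𝓝[>] 0, f (x + t • v) ≤ f x + t * c) : L v ≤ c := by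
  have h1 : HasDerivAt (fun t : ℝ => f (x + t • v) - t * c) (L v - c) 0 := by
    have := (h.hasLineDerivAt v).sub ((hasDerivAt_id (0 : ℝ)).mul_const c)
    rwa [one_mul] at this
  refine sub_nonpos.1 (h1.nonpos_of_eventually_le ?_)
  filter_upwards [hle] with t ht
  simp only [zero_smul, add_zero, zero_mul, sub_zero]
  linarith

/-- The gauge of the convex open set `Ω` with centre `x₀ ∈ Ω`: a convex function, positively
homogeneous about `x₀`, of class `C²` away from `x₀`, with `Ω = {g < 1}`. -/
structure IsRadialGauge {E : Type*} [NormedAddCommGroup E] [NormedSpace ℝ E] (Ω : Set E) (x₀ : E)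
    (g : E → ℝ) : Prop where
  continuous : Continuous g
  nonneg : ∀ x, 0 ≤ g x
  lt_one_iff : ∀ x, g x < 1 ↔ x ∈ Ω
  le_one_iff : ∀ x, g x ≤ 1 ↔ x ∈ closure Ω
  add_le : ∀ v v', g (x₀ + (v + v')) ≤ g (x₀ + v) + g (x₀ + v')
  homogeneous : ∀ t : ℝ, 0 ≤ t → ∀ v, g (x₀ + t • v) = t * g (x₀ + v)
  norm_le : ∃ C > 0, ∀ v, ‖v‖ ≤ C * g (x₀ + v)
  contDiffAt : ∀ x, x ≠ x₀ → ContDiffAt ℝ 2 g x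

section LocalDefiningFunction

variable {d : ℕ} {Ω : Set (EuclideanSpace ℝ (Fin d))} {p : EuclideanSpace ℝ (Fin d)}
  {U : Set (EuclideanSpace ℝ (Fin d))} {φ : EuclideanSpace ℝ (Fin d) → ℝ}

theorem IsLocalDefiningFunction.contDiffAt (h : IsLocalDefiningFunction Ω p U φ)
    {q : EuclideanSpace ℝ (Fin d)} (hq : q ∈ U) : ContDiffAt ℝ 2 φ q :=
  h.contDiffOn.contDiffAt (h.isOpen.mem_nhds hq)

theorem IsLocalDefiningFunction.eq_zero (h : IsLocalDefiningFunction Ω p U φ) (hΩ : IsOpen Ω)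
    {q : EuclideanSpace ℝ (Fin d)} (hq : q ∈ U) (hqf : q ∈ frontier Ω) : φ q = 0 := by
  rw [hΩ.frontier_eq] at hqf
  refine le_antisymm ?_ (not_lt.1 fun hlt => hqf.2 ((h.mem_iff q hq).2 hlt))
  refine le_of_tendsto_of_frequently (h.contDiffAt hq).continuousAt.tendsto ?_
  refine ((mem_closure_iff_frequently.1 hqf.1).and_eventually (h.isOpen.mem_nhds hq)).mono ?_
  exact fun z hz => ((h.mem_iff z hz.2).1 hz.1).le

/-- The radial derivative of a defining function of a convex set is positive. -/
theorem IsLocalDefiningFunction.fderiv_radial_pos (h : IsLocalDefiningFunction Ω p U φ)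
    (hΩ : IsOpen Ω) (hconv : Convex ℝ Ω) (hp : p ∈ frontier Ω) {x₀ : EuclideanSpace ℝ (Fin d)}
    (hx₀ : x₀ ∈ Ω) : 0 < fderiv ℝ φ p (p - x₀) := by
  have hd : HasFDerivAt φ (fderiv ℝ φ p) p :=
    ((h.contDiffAt h.mem).differentiableAt two_ne_zero).hasFDerivAt
  have hφp := h.eq_zero hΩ h.mem hp
  have hle : ∀ z ∈ Ω, fderiv ℝ φ p (z - p) ≤ 0 := by
    intro z hz
    refine hd.apply_le_of_eventually_le ?_
    have hlim : Tendsto (fun t : ℝ => p + t • (z - p)) (𝓝[>] 0) (𝓝 p) := by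
      have : Continuous fun t : ℝ => p + t • (z - p) := by fun_prop
      simpa using (this.tendsto 0).mono_left nhdsWithin_le_nhds
    filter_upwards [hlim.eventually (h.isOpen.mem_nhds h.mem),
      Ioo_mem_nhdsGT (zero_lt_one' ℝ)] with t hU ht
    rw [hφp, mul_zero, add_zero]
    refine ((h.mem_iff _ hU).1 ?_).le
    have := hconv.add_smul_sub_mem_interior' (frontier_subset_closure hp)
      (hΩ.interior_eq.symm ▸ hz) ⟨ht.1, ht.2.le⟩
    rwa [hΩ.interior_eq] at this
  have h0 := hle x₀ hx₀
  have hneg : fderiv ℝ φ p (p - x₀) = -fderiv ℝ φ p (x₀ - p) := by rw [← map_neg, neg_sub]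
  rw [hneg]
  refine neg_pos.2 (lt_of_le_of_ne h0 fun heq => ?_)
  -- otherwise the gradient itself would be a direction into `Ω` increasing `φ`
  set e := gradient φ p with he
  have hlim : Tendsto (fun t : ℝ => x₀ + t • e) (𝓝[>] 0) (𝓝 x₀) := by
    have : Continuous fun t : ℝ => x₀ + t • e := by fun_prop
    simpa using (this.tendsto 0).mono_left nhdsWithin_le_nhds
  obtain ⟨t, ht, ht0⟩ := ((hlim.eventually (hΩ.mem_nhds hx₀)).and self_mem_nhdsWithin).exists
  have h1 := hle _ ht
  rw [add_sub_right_comm, map_add, heq, zero_add, map_smul, ← inner_gradient_left, ← he,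
    real_inner_self_eq_norm_sq, smul_eq_mul] at h1
  have h2 : 0 < ‖e‖ ^ 2 := pow_pos (norm_pos_iff.2 h.gradient_ne_zero) 2
  exact absurd h1 (not_le.2 (mul_pos ht0 h2))

end LocalDefiningFunction

theorem isInvertible_of_apply_one_ne_zero {L : ℝ →L[ℝ] ℝ} (h : L 1 ≠ 0) : L.IsInvertible := by
  refine ⟨ContinuousLinearEquiv.unitsEquivAut ℝ (Units.mk0 (L 1) h), ?_⟩
  ext
  simp

/-- The gauge of a bounded convex open set with `C²` boundary is of class `C²` away from the
centre: `1 / g` solves the implicit equation `φ(x₀ + t (x - x₀)) = 0` for `t`, where `φ` is a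
local defining function. -/
theorem exists_isRadialGauge {d : ℕ} {Ω : Set (EuclideanSpace ℝ (Fin d))} (hΩ : IsOpen Ω)
    (hbdd : Bornology.IsBounded Ω) (hconv : Convex ℝ Ω) (hC2 : HasC2Boundary Ω)
    {x₀ : EuclideanSpace ℝ (Fin d)} (hx₀ : x₀ ∈ Ω) : ∃ g, IsRadialGauge Ω x₀ g := by
  set K : Set (EuclideanSpace ℝ (Fin d)) := (fun z => x₀ + z) ⁻¹' Ω with hK
  have hKo : IsOpen K := hΩ.preimage (continuous_const.add continuous_id)
  have hKc : Convex ℝ K := hconv.translate_preimage_right x₀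
  have hK0 : K ∈ 𝓝 0 := hKo.mem_nhds (by simpa [hK] using hx₀)
  have hKa : Absorbent ℝ K := absorbent_nhds_zero hK0
  have hKcl : ∀ z, z ∈ closure K ↔ x₀ + z ∈ closure Ω := fun z => by
    rw [← mem_preimage (f := fun z => x₀ + z)]
    exact Set.ext_iff.1 ((Homeomorph.addLeft x₀).preimage_closure Ω).symm z
  obtain ⟨C, hC0, hC⟩ : ∃ C > 0, K ⊆ Metric.closedBall 0 C := by
    obtain ⟨C, hC⟩ := hbdd.subset_closedBall x₀
    refine ⟨max C 1, by positivity, fun z hz => ?_⟩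
    have := hC hz
    rw [Metric.mem_closedBall, dist_eq_norm, add_sub_cancel_left] at this
    exact mem_closedBall_zero_iff.2 (this.trans (le_max_left _ _))
  set g : EuclideanSpace ℝ (Fin d) → ℝ := fun x => gauge K (x - x₀) with hg
  have hgv : ∀ v, g (x₀ + v) = gauge K v := fun v => by simp [hg]
  have hgcont : Continuous g := (continuous_gauge hKc hK0).comp (continuous_id.sub continuous_const)
  have hlt : ∀ x, g x < 1 ↔ x ∈ Ω := fun x => by
    rw [hg, gauge_lt_one_iff_mem_interior hKc hK0, hKo.interior_eq, hK, mem_preimage,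
      add_sub_cancel]
  have hle : ∀ x, g x ≤ 1 ↔ x ∈ closure Ω := fun x => by
    rw [hg, gauge_le_one_iff_mem_closure hKc hK0, hKcl, add_sub_cancel]
  have hhom : ∀ t : ℝ, 0 ≤ t → ∀ v, g (x₀ + t • v) = t * g (x₀ + v) := fun t ht v => by
    rw [hgv, hgv, gauge_smul_of_nonneg ht, smul_eq_mul]
  have hnorm : ∀ v, ‖v‖ ≤ C * g (x₀ + v) := fun v => by
    rw [hgv, ← div_le_iff₀' hC0]; exact le_gauge_of_subset_closedBall hKa hC0.le hC
  refine ⟨g, hgcont, fun x => gauge_nonneg _, hlt, hle, fun v v' => ?_, hhom, ⟨C, hC0, hnorm⟩,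
    fun x hx => ?_⟩
  · simp_rw [hgv]; exact gauge_add_le hKc hKa v v'
  have hpos : ∀ y, y ≠ x₀ → 0 < g y := fun y hy => by
    have h1 := hnorm (y - x₀)
    rw [add_sub_cancel] at h1
    exact pos_of_mul_pos_right ((norm_pos_iff.2 (sub_ne_zero.2 hy)).trans_le h1) hC0.le
  -- the radial projection to the boundary
  have hfr : ∀ y, y ≠ x₀ → x₀ + (g y)⁻¹ • (y - x₀) ∈ frontier Ω := fun y hy => by
    have h1 : g (x₀ + (g y)⁻¹ • (y - x₀)) = 1 := by
      rw [hhom _ (inv_nonneg.2 (hpos y hy).le), add_sub_cancel, inv_mul_cancel₀ (hpos y hy).ne']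
    rw [hΩ.frontier_eq]
    exact ⟨(hle _).1 h1.le, fun h => ((hlt _).2 h).ne h1⟩
  set p := x₀ + (g x)⁻¹ • (x - x₀) with hp
  obtain ⟨U, φ, hφ⟩ := hC2 p (hfr x hx)
  set F : EuclideanSpace ℝ (Fin d) × ℝ → ℝ := fun z => φ (x₀ + z.2 • (z.1 - x₀)) with hF
  have hin : ContDiff ℝ 2 fun z : EuclideanSpace ℝ (Fin d) × ℝ => x₀ + z.2 • (z.1 - x₀) := by
    fun_prop
  have hFc : ContDiffAt ℝ 2 F (x, (g x)⁻¹) :=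
    ContDiffAt.comp (x, (g x)⁻¹) (hφ.contDiffAt hφ.mem) hin.contDiffAt
  have hinv : (fderiv ℝ F (x, (g x)⁻¹) ∘L .inr ℝ (EuclideanSpace ℝ (Fin d)) ℝ).IsInvertible := by
    refine isInvertible_of_apply_one_ne_zero ?_
    have h1 : HasDerivAt (fun t : ℝ => φ (x₀ + t • (x - x₀))) (fderiv ℝ φ p (x - x₀)) (g x)⁻¹ := by
      have h2 : HasDerivAt (fun t : ℝ => x₀ + t • (x - x₀)) (x - x₀) (g x)⁻¹ := by
        simpa using ((hasDerivAt_id (g x)⁻¹).smul_const (x - x₀)).const_add x₀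
      exact ((hφ.contDiffAt hφ.mem).differentiableAt two_ne_zero).hasFDerivAt.comp_hasDerivAt
        (g x)⁻¹ h2
    have h3 : HasDerivAt (fun t : ℝ => F (x, t))
        (fderiv ℝ F (x, (g x)⁻¹) ((0 : EuclideanSpace ℝ (Fin d)), (1 : ℝ))) (g x)⁻¹ :=
      (hFc.differentiableAt two_ne_zero).hasFDerivAt.comp_hasDerivAt (g x)⁻¹
        ((hasDerivAt_const _ x).prodMk (hasDerivAt_id _))
    have h4 := hφ.fderiv_radial_pos hΩ hconv (hfr x hx) hx₀
    rw [hp, add_sub_cancel_left, map_smul, smul_eq_mul, ← hp] at h4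
    have h5 : 0 < fderiv ℝ φ p (x - x₀) :=
      pos_of_mul_pos_right h4 (inv_nonneg.2 (hpos x hx).le)
    simpa using (h1.unique h3 ▸ h5.ne' :
      fderiv ℝ F (x, (g x)⁻¹) ((0 : EuclideanSpace ℝ (Fin d)), (1 : ℝ)) ≠ 0)
  have hψ := hFc.contDiffAt_implicitFunction two_ne_zero hinv
  have hev := hFc.eventually_apply_eq_iff_implicitFunction two_ne_zero hinv
  have hginv : ContinuousAt (fun y => (g y)⁻¹) x :=
    hgcont.continuousAt.inv₀ (hpos x hx).ne'
  have hlim : Tendsto (fun y => (y, (g y)⁻¹)) (𝓝 x) (𝓝 (x, (g x)⁻¹)) :=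
    continuousAt_id.prodMk hginv
  have hlimU : ∀ᶠ y in 𝓝 x, x₀ + (g y)⁻¹ • (y - x₀) ∈ U :=
    (hin.continuous.continuousAt.tendsto.comp hlim).eventually (hφ.isOpen.mem_nhds hφ.mem)
  have heq : (fun y => (g y)⁻¹) =ᶠ[𝓝 x] hFc.implicitFunction two_ne_zero hinv := by
    filter_upwards [hlim.eventually hev, hlimU, isOpen_ne.mem_nhds hx] with y h1 h2 h3
    refine (h1.1 ?_).symm
    have h4 : φ p = 0 := hφ.eq_zero hΩ hφ.mem (hfr x hx)
    have h5 := hφ.eq_zero hΩ h2 (hfr y h3)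
    exact h5.trans h4.symm
  have h6 := (hψ.congr_of_eventuallyEq heq).inv (inv_ne_zero (hpos x hx).ne')
  rwa [show (fun y => (g y)⁻¹)⁻¹ = g from funext fun y => inv_inv (g y)] at h6

end RadialGauge

/-! ### The signed distance to the boundary -/

section SignedDistance

/-- The unit normal to the level sets of `g`. -/
noncomputable def levelNormal {d : ℕ} (g : EuclideanSpace ℝ (Fin d) → ℝ)
    (x : EuclideanSpace ℝ (Fin d)) : EuclideanSpace ℝ (Fin d) :=
  ‖gradient g x‖⁻¹ • gradient g x

/-- The distance to the boundary of `Ω`, counted negatively inside `Ω` (if `Ω` and its complement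
are nonempty). -/
noncomputable def boundaryDist {d : ℕ} (Ω : Set (EuclideanSpace ℝ (Fin d)))
    (x : EuclideanSpace ℝ (Fin d)) : ℝ :=
  Metric.infDist x Ω - Metric.infDist x Ωᶜ

variable {d : ℕ} {Ω : Set (EuclideanSpace ℝ (Fin d))} {x₀ : EuclideanSpace ℝ (Fin d)}
  {g : EuclideanSpace ℝ (Fin d) → ℝ}

namespace IsRadialGauge

theorem apply_center (hg : IsRadialGauge Ω x₀ g) : g x₀ = 0 := by
  simpa using hg.homogeneous 0 le_rfl 0

theorem pos (hg : IsRadialGauge Ω x₀ g) {x : EuclideanSpace ℝ (Fin d)} (hx : x ≠ x₀) :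
    0 < g x := by
  obtain ⟨C, hC0, hC⟩ := hg.norm_le
  have h1 := hC (x - x₀)
  rw [add_sub_cancel] at h1
  exact pos_of_mul_pos_right ((norm_pos_iff.2 (sub_ne_zero.2 hx)).trans_le h1) hC0.le

theorem ne_center_of_pos (hg : IsRadialGauge Ω x₀ g) {x : EuclideanSpace ℝ (Fin d)}
    (hx : 0 < g x) : x ≠ x₀ := by
  rintro rfl
  exact hx.ne' hg.apply_center

theorem isOpen (hg : IsRadialGauge Ω x₀ g) : IsOpen Ω := by
  rw [show Ω = {x | g x < 1} from Set.ext fun x => (hg.lt_one_iff x).symm]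
  exact isOpen_lt hg.continuous continuous_const

theorem mem_frontier_iff (hg : IsRadialGauge Ω x₀ g) {x : EuclideanSpace ℝ (Fin d)} :
    x ∈ frontier Ω ↔ g x = 1 := by
  rw [hg.isOpen.frontier_eq, Set.mem_sdiff, ← hg.le_one_iff, ← hg.lt_one_iff, not_lt]
  exact ⟨fun h => h.1.antisymm h.2, fun h => ⟨h.le, h.ge⟩⟩

theorem ne_center (hg : IsRadialGauge Ω x₀ g) {x : EuclideanSpace ℝ (Fin d)}
    (hx : x ∈ frontier Ω) : x ≠ x₀ :=
  hg.ne_center_of_pos (by rw [hg.mem_frontier_iff.1 hx]; exact one_pos)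

theorem hasFDerivAt (hg : IsRadialGauge Ω x₀ g) {x : EuclideanSpace ℝ (Fin d)} (hx : x ≠ x₀) :
    HasFDerivAt g (fderiv ℝ g x) x :=
  ((hg.contDiffAt x hx).differentiableAt two_ne_zero).hasFDerivAt

/-- Euler's identity. -/
theorem fderiv_radial (hg : IsRadialGauge Ω x₀ g) {x : EuclideanSpace ℝ (Fin d)} (hx : x ≠ x₀) :
    fderiv ℝ g x (x - x₀) = g x := by
  have h1 : HasDerivAt (fun t : ℝ => g (x + t • (x - x₀))) (fderiv ℝ g x (x - x₀)) 0 :=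
    (hg.hasFDerivAt hx).hasLineDerivAt (x - x₀)
  have h2 : HasDerivAt (fun t : ℝ => (1 + t) * g x) (g x) 0 := by
    simpa using ((hasDerivAt_id (0 : ℝ)).const_add 1).mul_const (g x)
  refine h1.unique (h2.congr_of_eventuallyEq ?_)
  filter_upwards [lt_mem_nhds (neg_one_lt_zero (R := ℝ))] with t ht
  have h3 := hg.homogeneous (1 + t) (by linarith) (x - x₀)
  rw [add_sub_cancel] at h3
  rw [← h3]
  congr 1
  module

/-- Convexity of the gauge, along the segment from `x` to `y`. -/
theorem segment_le (hg : IsRadialGauge Ω x₀ g) (x y : EuclideanSpace ℝ (Fin d)) {t : ℝ}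
    (ht : t ∈ Icc (0 : ℝ) 1) : g (x + t • (y - x)) ≤ g x + t * (g y - g x) := by
  have h1 := hg.add_le ((1 - t) • (x - x₀)) (t • (y - x₀))
  rw [hg.homogeneous _ (sub_nonneg.2 ht.2), hg.homogeneous _ ht.1, add_sub_cancel,
    add_sub_cancel] at h1
  rw [show x + t • (y - x) = x₀ + ((1 - t) • (x - x₀) + t • (y - x₀)) by module]
  linarith

/-- The tangent inequality of the convex function `g`. -/
theorem tangent_le (hg : IsRadialGauge Ω x₀ g) {x : EuclideanSpace ℝ (Fin d)} (hx : x ≠ x₀)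
    (y : EuclideanSpace ℝ (Fin d)) : g x + fderiv ℝ g x (y - x) ≤ g y := by
  have h := (hg.hasFDerivAt hx).apply_le_of_eventually_le (v := y - x) (c := g y - g x) (by
    filter_upwards [Ioo_mem_nhdsGT (zero_lt_one' ℝ)] with t ht
    exact hg.segment_le x y (Ioo_subset_Icc_self ht))
  linarith

theorem gradient_ne_zero (hg : IsRadialGauge Ω x₀ g) {x : EuclideanSpace ℝ (Fin d)}
    (hx : x ≠ x₀) : gradient g x ≠ 0 := by
  intro h
  have h1 := hg.fderiv_radial hx
  rw [← inner_gradient_left, h, inner_zero_left] at h1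
  exact (hg.pos hx).ne h1

theorem norm_levelNormal (hg : IsRadialGauge Ω x₀ g) {x : EuclideanSpace ℝ (Fin d)}
    (hx : x ≠ x₀) : ‖levelNormal g x‖ = 1 :=
  norm_smul_inv_norm (𝕜 := ℝ) (hg.gradient_ne_zero hx)

theorem inner_levelNormal (x v : EuclideanSpace ℝ (Fin d)) :
    inner ℝ (levelNormal g x) v = ‖gradient g x‖⁻¹ * fderiv ℝ g x v := by
  rw [levelNormal, real_inner_smul_left, inner_gradient_left]

theorem continuousAt_levelNormal (hg : IsRadialGauge Ω x₀ g) {x : EuclideanSpace ℝ (Fin d)}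
    (hx : x ≠ x₀) : ContinuousAt (levelNormal g) x := by
  have h1 : ContinuousAt (fderiv ℝ g) x :=
    ((hg.contDiffAt x hx).fderiv_right (m := 1) (by norm_num)).continuousAt
  have h2 : ContinuousAt (gradient g) x :=
    (InnerProductSpace.toDual ℝ _).symm.continuous.continuousAt.comp h1
  exact (h2.norm.inv₀ (norm_ne_zero_iff.2 (hg.gradient_ne_zero hx))).smul h2

/-- `g - 1` is a defining function of `Ω` near each boundary point. -/
theorem isOutwardUnitNormal (hg : IsRadialGauge Ω x₀ g) {p : EuclideanSpace ℝ (Fin d)}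
    (hp : p ∈ frontier Ω) : IsOutwardUnitNormal Ω p (levelNormal g p) := by
  have hgrad : ∀ x, gradient (fun z => g z - 1) x = gradient g x := fun x => by
    simp only [gradient, fderiv_sub_const]
  refine ⟨{x₀}ᶜ, fun x => g x - 1, ⟨isOpen_compl_singleton, hg.ne_center hp, fun x hx => ?_, ?_,
    fun z _ => ?_⟩, by rw [hgrad]; rfl⟩
  · exact ((hg.contDiffAt x hx).sub contDiffAt_const).contDiffWithinAt
  · rw [hgrad]; exact hg.gradient_ne_zero (hg.ne_center hp)
  · rw [← hg.lt_one_iff, sub_neg]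

theorem inner_levelNormal_neg (hg : IsRadialGauge Ω x₀ g) {p z : EuclideanSpace ℝ (Fin d)}
    (hp : p ∈ frontier Ω) (hz : z ∈ Ω) : inner ℝ (levelNormal g p) (z - p) < 0 := by
  rw [inner_levelNormal]
  refine mul_neg_of_pos_of_neg
    (inv_pos.2 (norm_pos_iff.2 (hg.gradient_ne_zero (hg.ne_center hp)))) ?_
  have h1 := hg.tangent_le (hg.ne_center hp) z
  rw [hg.mem_frontier_iff.1 hp] at h1
  linarith [(hg.lt_one_iff z).2 hz]

theorem eventually_lt (hg : IsRadialGauge Ω x₀ g) {p v : EuclideanSpace ℝ (Fin d)}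
    (hp : p ≠ x₀) (hv : fderiv ℝ g p v < 0) : ∀ᶠ t : ℝ in 𝓝[>] 0, g (p + t • v) < g p := by
  have h : HasDerivAt (fun t : ℝ => g p - g (p + t • v)) (-fderiv ℝ g p v) 0 := by
    have := (hasDerivAt_const (0 : ℝ) (g p)).sub ((hg.hasFDerivAt hp).hasLineDerivAt v)
    rwa [zero_sub] at this
  filter_upwards [h.eventually_pos_of_pos (by simp) (neg_pos.2 hv)] with t ht using sub_pos.1 ht

theorem eventually_gt (hg : IsRadialGauge Ω x₀ g) {p v : EuclideanSpace ℝ (Fin d)}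
    (hp : p ≠ x₀) (hv : 0 < fderiv ℝ g p v) : ∀ᶠ t : ℝ in 𝓝[>] 0, g p < g (p + t • v) := by
  have h : HasDerivAt (fun t : ℝ => g (p + t • v) - g p) (fderiv ℝ g p v) 0 := by
    have := ((hg.hasFDerivAt hp).hasLineDerivAt v).sub (hasDerivAt_const (0 : ℝ) (g p))
    rwa [sub_zero] at this
  filter_upwards [h.eventually_pos_of_pos (by simp) hv] with t ht using sub_pos.1 ht

end IsRadialGauge

/-- Farkas' lemma for one constraint: if `⟨a, v⟩ < 0` forces `⟨b, v⟩ ≤ 0`, then `b` is a nonnegative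
multiple of `a`. -/
theorem eq_smul_of_forall_inner {E : Type*} [NormedAddCommGroup E] [InnerProductSpace ℝ E]
    {a b : E} (ha : a ≠ 0) (h : ∀ v, inner ℝ a v < 0 → inner ℝ b v ≤ 0) :
    b = ‖b‖ • ‖a‖⁻¹ • a := by
  have hal : ∀ v, inner ℝ a v ≤ 0 → inner ℝ b v ≤ 0 := by
    intro v hv
    have hlim : Tendsto (fun t : ℝ => inner ℝ b (v - t • a)) (𝓝[>] 0) (𝓝 (inner ℝ b v)) := by
      have : Continuous fun t : ℝ => inner ℝ b (v - t • a) := by fun_prop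
      simpa using (this.tendsto 0).mono_left nhdsWithin_le_nhds
    refine le_of_tendsto hlim ?_
    filter_upwards [self_mem_nhdsWithin] with t ht
    refine h _ ?_
    rw [inner_sub_right, real_inner_smul_right, real_inner_self_eq_norm_sq]
    have : 0 < t * ‖a‖ ^ 2 := mul_pos ht (pow_pos (norm_pos_iff.2 ha) 2)
    linarith
  have ha2 : ‖a‖ ^ 2 ≠ 0 := pow_ne_zero 2 (norm_ne_zero_iff.2 ha)
  -- the component of `b` orthogonal to `a` vanishes
  set c := inner ℝ a b / ‖a‖ ^ 2 with hc
  have h0 : inner ℝ a (b - c • a) = 0 := by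
    rw [inner_sub_right, real_inner_smul_right, real_inner_self_eq_norm_sq, hc,
      div_mul_cancel₀ _ ha2, sub_self]
  have h1 := hal _ h0.le
  have h2 : inner ℝ (b - c • a) (b - c • a) ≤ 0 := by
    rw [inner_sub_left, real_inner_smul_left, h0, mul_zero, sub_zero]
    exact h1
  have h3 : b = c • a := sub_eq_zero.1 (real_inner_self_nonpos.1 h2)
  have hc0 : 0 ≤ c := by
    have h4 := hal (-a) (by
      rw [inner_neg_right, real_inner_self_eq_norm_sq]; exact neg_nonpos.2 (sq_nonneg _))
    rw [inner_neg_right, neg_nonpos, real_inner_comm] at h4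
    exact div_nonneg h4 (sq_nonneg _)
  rw [h3, norm_smul, Real.norm_of_nonneg hc0, smul_smul, mul_assoc,
    mul_inv_cancel₀ (norm_ne_zero_iff.2 ha), mul_one]

/-- First-order condition at a nearest point. -/
theorem inner_nonpos_of_infDist_eq {E : Type*} [NormedAddCommGroup E] [InnerProductSpace ℝ E]
    {S : Set E} {x p v : E} (hp : Metric.infDist x S = dist x p)
    (hv : ∀ᶠ t : ℝ in 𝓝[>] 0, p + t • v ∈ S) : inner ℝ (x - p) v ≤ 0 := by
  have hlim : Tendsto (fun t : ℝ => t * ‖v‖ ^ 2 / 2) (𝓝[>] 0) (𝓝 0) := by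
    have : Continuous fun t : ℝ => t * ‖v‖ ^ 2 / 2 := by fun_prop
    simpa using (this.tendsto 0).mono_left nhdsWithin_le_nhds
  refine ge_of_tendsto hlim ?_
  filter_upwards [hv, self_mem_nhdsWithin] with t ht ht0
  have ht0 : 0 < t := ht0
  have h1 := Metric.infDist_le_dist_of_mem ht (x := x)
  rw [hp, dist_eq_norm, dist_eq_norm, ← sub_sub] at h1
  have h2 := pow_le_pow_left₀ (norm_nonneg _) h1 2
  rw [norm_sub_sq_real (x - p), real_inner_smul_right, norm_smul, Real.norm_of_nonneg ht0.le] at h2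
  have h3 : t * inner ℝ (x - p) v ≤ t * (t * ‖v‖ ^ 2 / 2) := by linarith
  exact le_of_mul_le_mul_left h3 ht0

/-- A nearest point interior to the set is the point itself. -/
theorem eq_of_infDist_eq_of_mem_nhds {E : Type*} [NormedAddCommGroup E] [InnerProductSpace ℝ E]
    {S : Set E} {x p : E} (hp : Metric.infDist x S = dist x p) (hS : S ∈ 𝓝 p) : x = p := by
  have h : inner ℝ (x - p) (x - p) ≤ 0 := by
    refine inner_nonpos_of_infDist_eq hp ?_
    have hlim : Tendsto (fun t : ℝ => p + t • (x - p)) (𝓝[>] 0) (𝓝 p) := by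
      have : Continuous fun t : ℝ => p + t • (x - p) := by fun_prop
      simpa using (this.tendsto 0).mono_left nhdsWithin_le_nhds
    exact hlim hS
  exact sub_eq_zero.1 (real_inner_self_nonpos.1 h)

namespace IsRadialGauge

/-- Every point lies on the normal line through one of its nearest boundary points. -/
theorem exists_eq_add_boundaryDist_smul (hg : IsRadialGauge Ω x₀ g) (hne : Ωᶜ.Nonempty)
    (x : EuclideanSpace ℝ (Fin d)) :
    ∃ p ∈ frontier Ω, x = p + boundaryDist Ω x • levelNormal g p := by
  have hx₀ : x₀ ∈ Ω := (hg.lt_one_iff x₀).1 (by rw [hg.apply_center]; exact one_pos)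
  by_cases hx : x ∈ Ω
  · obtain ⟨p, hpS, hp⟩ := hg.isOpen.isClosed_compl.exists_infDist_eq_dist hne x
    have hpx : x ≠ p := fun h => hpS (h ▸ hx)
    have h1 : g p = 1 := by
      refine le_antisymm (not_lt.1 fun hlt => hpx (eq_of_infDist_eq_of_mem_nhds hp ?_))
        (not_lt.1 fun h => hpS ((hg.lt_one_iff p).1 h))
      filter_upwards [hg.continuous.continuousAt.eventually (lt_mem_nhds hlt)] with z hz hzΩ
      exact lt_asymm hz ((hg.lt_one_iff z).2 hzΩ)
    have hpf := hg.mem_frontier_iff.2 h1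
    have hp0 := hg.ne_center hpf
    have h2 := eq_smul_of_forall_inner (a := -gradient g p) (b := x - p)
      (neg_ne_zero.2 (hg.gradient_ne_zero hp0)) fun v hv => by
        refine inner_nonpos_of_infDist_eq hp ?_
        rw [inner_neg_left, inner_gradient_left, neg_lt_zero] at hv
        filter_upwards [hg.eventually_gt hp0 hv] with t ht hmem
        exact lt_asymm ((hg.lt_one_iff _).2 hmem) (h1 ▸ ht)
    refine ⟨p, hpf, ?_⟩
    rw [boundaryDist, Metric.infDist_zero_of_mem hx, hp, dist_eq_norm, zero_sub, levelNormal,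
      ← sub_eq_iff_eq_add']
    rw [norm_neg, smul_neg, smul_neg] at h2
    rw [neg_smul]
    exact h2
  · obtain ⟨p, hpS, hp⟩ := isClosed_closure.exists_infDist_eq_dist
      (Set.Nonempty.closure ⟨x₀, hx₀⟩) x
    rw [Metric.infDist_closure] at hp
    have h1 : g p = 1 := by
      refine le_antisymm ((hg.le_one_iff p).2 hpS) (not_lt.1 fun hlt => ?_)
      have hpΩ := (hg.lt_one_iff p).1 hlt
      exact hx (eq_of_infDist_eq_of_mem_nhds hp (hg.isOpen.mem_nhds hpΩ) ▸ hpΩ)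
    have hpf := hg.mem_frontier_iff.2 h1
    have hp0 := hg.ne_center hpf
    have h2 := eq_smul_of_forall_inner (a := gradient g p) (b := x - p)
      (hg.gradient_ne_zero hp0) fun v hv => by
        refine inner_nonpos_of_infDist_eq hp ?_
        rw [inner_gradient_left] at hv
        filter_upwards [hg.eventually_lt hp0 hv] with t ht
        exact (hg.lt_one_iff _).1 (h1 ▸ ht)
    refine ⟨p, hpf, ?_⟩
    rw [boundaryDist, Metric.infDist_zero_of_mem (s := Ωᶜ) hx, hp, dist_eq_norm, sub_zero,
      levelNormal, ← sub_eq_iff_eq_add']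
    exact h2

/-- The signed distance dominates the affine functions vanishing on tangent hyperplanes. -/
theorem inner_levelNormal_le_boundaryDist (hg : IsRadialGauge Ω x₀ g)
    {p : EuclideanSpace ℝ (Fin d)} (hp : p ∈ frontier Ω) (x : EuclideanSpace ℝ (Fin d)) :
    inner ℝ (levelNormal g p) (x - p) ≤ boundaryDist Ω x := by
  have hx₀ : x₀ ∈ Ω := (hg.lt_one_iff x₀).1 (by rw [hg.apply_center]; exact one_pos)
  have hn := hg.norm_levelNormal (hg.ne_center hp)
  set n := levelNormal g p with hndef
  by_cases hx : x ∈ Ω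
  · have hneg := hg.inner_levelNormal_neg hp hx
    rw [boundaryDist, Metric.infDist_zero_of_mem hx, zero_sub, le_neg]
    -- the projection of `x` to the tangent hyperplane at `p` lies outside `Ω`
    have hmem : x - inner ℝ n (x - p) • n ∈ Ωᶜ := fun h => by
      have h1 := hg.inner_levelNormal_neg hp h
      rw [sub_right_comm, inner_sub_right, real_inner_smul_right, real_inner_self_eq_norm_sq, hn,
        one_pow, mul_one, sub_self] at h1
      exact h1.false
    refine (Metric.infDist_le_dist_of_mem hmem).trans (le_of_eq ?_)
    rw [dist_eq_norm, sub_sub_cancel, norm_smul, hn, mul_one, Real.norm_of_nonpos hneg.le]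
  · rw [boundaryDist, Metric.infDist_zero_of_mem (s := Ωᶜ) hx, sub_zero,
      Metric.le_infDist ⟨x₀, hx₀⟩]
    intro z hz
    have h1 := hg.inner_levelNormal_neg hp hz
    have h2 : inner ℝ n (x - z) ≤ dist x z := by
      rw [dist_eq_norm]
      exact (real_inner_le_norm _ _).trans (by rw [hn, one_mul])
    have h3 : inner ℝ n (x - p) = inner ℝ n (x - z) + inner ℝ n (z - p) := by
      rw [← inner_add_right, sub_add_sub_cancel]
    linarith

/-- The hypothesis on `Ωᶜ` is needed because `Metric.infDist x ∅ = 0`. -/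
theorem boundaryDist_neg_iff (hg : IsRadialGauge Ω x₀ g) (hne : Ωᶜ.Nonempty)
    (x : EuclideanSpace ℝ (Fin d)) : boundaryDist Ω x < 0 ↔ x ∈ Ω := by
  by_cases hx : x ∈ Ω
  · have := (hg.isOpen.isClosed_compl.notMem_iff_infDist_pos hne).1 (not_not.2 hx)
    simp only [hx, iff_true, boundaryDist, Metric.infDist_zero_of_mem hx]
    linarith
  · simp only [hx, iff_false, boundaryDist, Metric.infDist_zero_of_mem (s := Ωᶜ) hx, sub_zero,
      not_lt]
    exact Metric.infDist_nonneg

end IsRadialGauge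

theorem continuous_boundaryDist : Continuous (boundaryDist Ω) :=
  (Metric.continuous_infDist_pt Ω).sub (Metric.continuous_infDist_pt Ωᶜ)

/-- If `κ` does not increase along the outward normal lines, then `Ω` is geodesically convex. -/
theorem IsRadialGauge.isGeodesicallyConvex (hg : IsRadialGauge Ω x₀ g)
    {κ : EuclideanSpace ℝ (Fin d) → ℝ} {m M : ℝ} (hm : 0 < m) (hκ : ∀ z, κ z ∈ Icc m M)
    (hC : ContDiff ℝ 1 κ) {l : ℝ} (hl : 0 < l)
    (hmono : ∀ p ∈ frontier Ω, ∀ r, -l < r → (0 ≤ r ∨ p + r • levelNormal g p ∈ Ω) →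
      fderiv ℝ κ (p + r • levelNormal g p) (levelNormal g p) ≤ 0) :
    IsGeodesicallyConvex κ Ω := by
  -- in dimension zero `Ω` is the whole space and has no boundary
  rcases Ωᶜ.eq_empty_or_nonempty with he | hne
  · rw [compl_empty_iff] at he
    subst he
    refine isGeodesicallyConvex_of_subgradient (H := fun _ => -1) hm hκ hC continuous_const
      (fun x => by simp) one_pos fun x hx => absurd hx (lt_irrefl _)
  refine isGeodesicallyConvex_of_subgradient hm hκ hC continuous_boundaryDist
    (fun x => (hg.boundaryDist_neg_iff hne x).symm) hl fun x hx => ?_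
  obtain ⟨p, hp, hxp⟩ := hg.exists_eq_add_boundaryDist_smul hne x
  refine ⟨levelNormal g p, fun x' => ?_, ?_⟩
  · refine le_trans (le_of_eq ?_) (hg.inner_levelNormal_le_boundaryDist hp x')
    rw [← sub_add_sub_cancel x' x p, inner_add_right, add_comm]
    congr 1
    nth_rewrite 2 [hxp]
    rw [add_sub_cancel_left, real_inner_smul_right, real_inner_self_eq_norm_sq,
      hg.norm_levelNormal (hg.ne_center hp), one_pow, mul_one]
  · have h := hmono p hp _ hx ?_
    · rwa [← hxp] at h
    · rw [← hxp]
      exact (le_or_gt 0 _).imp id (hg.boundaryDist_neg_iff hne x).1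

end SignedDistance

/-! ### Second-order reflection across a boundary -/

section Reflection

variable {E F : Type*} [NormedAddCommGroup E] [NormedSpace ℝ E] [NormedAddCommGroup F]
  [NormedSpace ℝ F] {A B V : Set E}

/-- Derivatives on two closed pieces covering the space glue to a derivative inside the open set
`V`, if they agree where the pieces meet. -/
theorem hasFDerivAt_of_hasFDerivWithinAt_of_closed_cover (hA : IsClosed A) (hB : IsClosed B)
    (hAB : A ∪ B = univ) (hV : IsOpen V) {f : E → F} {f' : E → E →L[ℝ] F}
    (hfA : ∀ x ∈ A, HasFDerivWithinAt f (f' x) A x)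
    (hfB : ∀ x ∈ B ∩ V, HasFDerivWithinAt f (f' x) (B ∩ V) x) {x : E} (hx : x ∈ V) :
    HasFDerivAt f (f' x) x := by
  have h1 : HasFDerivWithinAt f (f' x) A x := by
    by_cases h : x ∈ A
    · exact hfA x h
    · exact HasFDerivWithinAt.of_notMem_closure (by rwa [hA.closure_eq])
  have h2 : HasFDerivWithinAt f (f' x) (B ∩ V) x := by
    by_cases h : x ∈ B
    · exact hfB x ⟨h, hx⟩
    · exact HasFDerivWithinAt.of_notMem_closure fun hc =>
        h (hB.closure_subset (closure_mono inter_subset_left hc))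
  refine (h1.union h2).hasFDerivAt (mem_of_superset (hV.mem_nhds hx) fun z hz => ?_)
  rcases (hAB ▸ mem_univ z : z ∈ A ∪ B) with h | h
  · exact Or.inl h
  · exact Or.inr ⟨h, hz⟩

theorem continuousAt_of_continuousOn_closed_cover {X Y : Type*} [TopologicalSpace X]
    [TopologicalSpace Y] {A B V : Set X} (hA : IsClosed A) (hB : IsClosed B)
    (hAB : A ∪ B = univ) (hV : IsOpen V) {f : X → Y} (hfA : ContinuousOn f A)
    (hfB : ContinuousOn f (B ∩ V)) {x : X} (hx : x ∈ V) : ContinuousAt f x := by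
  have h1 : ContinuousWithinAt f A x := by
    by_cases h : x ∈ A
    · exact hfA x h
    · exact continuousWithinAt_of_notMem_closure (by rwa [hA.closure_eq])
  have h2 : ContinuousWithinAt f (B ∩ V) x := by
    by_cases h : x ∈ B
    · exact hfB x ⟨h, hx⟩
    · exact continuousWithinAt_of_notMem_closure fun hc =>
        h (hB.closure_subset (closure_mono inter_subset_left hc))
  refine (h1.union h2).continuousAt (mem_of_superset (hV.mem_nhds hx) fun z hz => ?_)
  rcases (hAB ▸ mem_univ z : z ∈ A ∪ B) with h | h
  · exact Or.inl h
  · exact Or.inr ⟨h, hz⟩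

/-- `C²` regularity from explicit first and second derivatives, the latter continuous. -/
theorem contDiffOn_two_of_hasFDerivAt (hV : IsOpen V) {f : E → F} {f' : E → E →L[ℝ] F}
    {f'' : E → E →L[ℝ] E →L[ℝ] F} (hf : ∀ x ∈ V, HasFDerivAt f (f' x) x)
    (hf' : ∀ x ∈ V, HasFDerivAt f' (f'' x) x) (hc : ContinuousOn f'' V) : ContDiffOn ℝ 2 f V := by
  have h1 : ContDiffOn ℝ 1 f' V := by
    rw [show (1 : WithTop ℕ∞) = 0 + 1 by norm_num, contDiffOn_succ_iff_fderiv_of_isOpen hV]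
    refine ⟨fun x hx => (hf' x hx).differentiableAt.differentiableWithinAt, by simp, ?_⟩
    rw [contDiffOn_zero]
    exact hc.congr fun x hx => (hf' x hx).fderiv
  rw [show (2 : WithTop ℕ∞) = 1 + 1 by norm_num, contDiffOn_succ_iff_fderiv_of_isOpen hV]
  exact ⟨fun x hx => (hf x hx).differentiableAt.differentiableWithinAt, by simp,
    h1.congr fun x hx => (hf x hx).fderiv⟩

theorem continuousOn_third_difference {X : Type*} [TopologicalSpace X] {S : Set X}
    {f₁ f₂ f₃ : X → F} (h₁ : ContinuousOn f₁ S) (h₂ : ContinuousOn f₂ S)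
    (h₃ : ContinuousOn f₃ S) :
    ContinuousOn (fun x => (3 : ℝ) • f₁ x - (3 : ℝ) • f₂ x + f₃ x) S :=
  ((h₁.const_smul (3 : ℝ)).sub (h₂.const_smul (3 : ℝ))).add h₃

/-- Extension by reflection of order two across the common boundary of `A` and `B`: for a `C²`
field `Z` vanishing on this boundary such that `x - a Z(x) ∈ A` for `a = 1, 2, 3`, the function
`3 κ(x - Z) - 3 κ(x - 2 Z) + κ(x - 3 Z)` has there the same derivatives up to the second order
as `κ`, because the third difference of a quadratic polynomial vanishes. -/
theorem exists_contDiffOn_extension_of_reflection (hA : IsClosed A) (hB : IsClosed B)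
    (hAB : A ∪ B = univ) (hV : IsOpen V) (huniq : UniqueDiffOn ℝ A) {κ : E → ℝ}
    (hκ : ContDiffOn ℝ 2 κ A) {Z : E → E} (hZ : ∀ x ∈ B ∩ V, ContDiffAt ℝ 2 Z x)
    (hmaps : ∀ x ∈ B ∩ V, ∀ a ∈ Icc (1 : ℝ) 3, x - a • Z x ∈ A)
    (hZ0 : ∀ x ∈ A ∩ B, Z x = 0) :
    ∃ f : E → ℝ, EqOn f κ A ∧ ContDiffOn ℝ 2 f V := by
  classical
  set D₁ : E → E →L[ℝ] ℝ := fderivWithin ℝ κ A with hD₁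
  set D₂ : E → E →L[ℝ] E →L[ℝ] ℝ := fderivWithin ℝ D₁ A with hD₂
  have hκ1 : ∀ y ∈ A, HasFDerivWithinAt κ (D₁ y) A y := fun y hy =>
    (hκ.differentiableOn two_ne_zero y hy).hasFDerivWithinAt
  have hD₁c : ContDiffOn ℝ 1 D₁ A := hκ.fderivWithin huniq (by norm_num)
  have hκ2 : ∀ y ∈ A, HasFDerivWithinAt D₁ (D₂ y) A y := fun y hy =>
    (hD₁c.differentiableOn one_ne_zero y hy).hasFDerivWithinAt
  have hD₂c : ContinuousOn D₂ A := hD₁c.continuousOn_fderivWithin huniq le_rfl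
  set R : ℝ → E → E := fun a x => x - a • Z x with hR
  set R₁ : ℝ → E → E →L[ℝ] E := fun a x => ContinuousLinearMap.id ℝ E - a • fderiv ℝ Z x with hR₁
  set R₂ : ℝ → E → E →L[ℝ] E →L[ℝ] E := fun a x => -(a • fderiv ℝ (fderiv ℝ Z) x) with hR₂
  have hZ1 : ∀ x ∈ B ∩ V, ContDiffAt ℝ 1 (fderiv ℝ Z) x := fun x hx =>
    (hZ x hx).fderiv_right (by norm_num)
  have hRd : ∀ a, ∀ x ∈ B ∩ V, HasFDerivAt (R a) (R₁ a x) x := fun a x hx =>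
    (hasFDerivAt_id x).sub
      (((hZ x hx).differentiableAt two_ne_zero).hasFDerivAt.const_smul a)
  have hR₁d : ∀ a, ∀ x ∈ B ∩ V, HasFDerivAt (R₁ a) (R₂ a x) x := fun a x hx =>
    (((hZ1 x hx).differentiableAt one_ne_zero).hasFDerivAt.const_smul a).const_sub _
  have hR₁c : ∀ a, ContinuousOn (R₁ a) (B ∩ V) := fun a x hx =>
    (hR₁d a x hx).continuousAt.continuousWithinAt
  have hRc : ∀ a, ContinuousOn (R a) (B ∩ V) := fun a x hx =>
    (hRd a x hx).continuousAt.continuousWithinAt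
  have hR₂c : ∀ a, ContinuousOn (R₂ a) (B ∩ V) := fun a x hx =>
    ((((hZ1 x hx).fderiv_right (m := 0) (by norm_num)).continuousAt.const_smul
      a).neg).continuousWithinAt
  have hmt : ∀ a ∈ Icc (1 : ℝ) 3, MapsTo (R a) (B ∩ V) A := fun a ha x hx => hmaps x hx a ha
  -- the derivatives of `κ ∘ R a`
  set T₁ : ℝ → E → E →L[ℝ] ℝ := fun a x => (D₁ (R a x)).comp (R₁ a x) with hT₁
  set T₂ : ℝ → E → E →L[ℝ] E →L[ℝ] ℝ := fun a x =>
    ((ContinuousLinearMap.compL ℝ E E ℝ) (D₁ (R a x))).comp (R₂ a x) +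
      ((ContinuousLinearMap.compL ℝ E E ℝ).flip (R₁ a x)).comp ((D₂ (R a x)).comp (R₁ a x))
    with hT₂
  have h1 : ∀ a ∈ Icc (1 : ℝ) 3, ∀ x ∈ B ∩ V,
      HasFDerivWithinAt (fun x => κ (R a x)) (T₁ a x) (B ∩ V) x := fun a ha x hx =>
    (hκ1 _ (hmt a ha hx)).comp x (hRd a x hx).hasFDerivWithinAt (hmt a ha)
  have h2 : ∀ a ∈ Icc (1 : ℝ) 3, ∀ x ∈ B ∩ V,
      HasFDerivWithinAt (T₁ a) (T₂ a x) (B ∩ V) x := fun a ha x hx =>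
    ((hκ2 _ (hmt a ha hx)).comp x (hRd a x hx).hasFDerivWithinAt (hmt a ha)).clm_comp
      (hR₁d a x hx).hasFDerivWithinAt
  have h3 : ∀ a ∈ Icc (1 : ℝ) 3, ContinuousOn (T₂ a) (B ∩ V) := fun a ha => by
    have hd1 : ContinuousOn (fun x => D₁ (R a x)) (B ∩ V) :=
      hD₁c.continuousOn.comp (hRc a) (hmt a ha)
    have hd2 : ContinuousOn (fun x => D₂ (R a x)) (B ∩ V) := hD₂c.comp (hRc a) (hmt a ha)
    exact ((((ContinuousLinearMap.compL ℝ E E ℝ).continuous.comp_continuousOn hd1)).clm_comp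
      (hR₂c a)).add ((((ContinuousLinearMap.compL ℝ E E ℝ).flip.continuous.comp_continuousOn
        (hR₁c a))).clm_comp (hd2.clm_comp (hR₁c a)))
  have i1 : (1 : ℝ) ∈ Icc (1 : ℝ) 3 := by norm_num
  have i2 : (2 : ℝ) ∈ Icc (1 : ℝ) 3 := by norm_num
  have i3 : (3 : ℝ) ∈ Icc (1 : ℝ) 3 := by norm_num
  set f : E → ℝ := fun x => if x ∈ A then κ x else
    (3 : ℝ) • κ (R 1 x) - (3 : ℝ) • κ (R 2 x) + κ (R 3 x) with hf
  set f' : E → E →L[ℝ] ℝ := fun x => if x ∈ A then D₁ x else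
    (3 : ℝ) • T₁ 1 x - (3 : ℝ) • T₁ 2 x + T₁ 3 x with hf'
  set f'' : E → E →L[ℝ] E →L[ℝ] ℝ := fun x => if x ∈ A then D₂ x else
    (3 : ℝ) • T₂ 1 x - (3 : ℝ) • T₂ 2 x + T₂ 3 x with hf''
  have hfA : EqOn f κ A := fun x hx => if_pos hx
  have hfA' : EqOn f' D₁ A := fun x hx => if_pos hx
  have hfA'' : EqOn f'' D₂ A := fun x hx => if_pos hx
  have hRx : ∀ x ∈ A ∩ B, ∀ a, R a x = x := fun x hx a => by simp [hR, hZ0 x hx]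
  have hfB : EqOn f (fun x => (3 : ℝ) • κ (R 1 x) - (3 : ℝ) • κ (R 2 x) + κ (R 3 x)) (B ∩ V) := by
    intro x hx
    by_cases h : x ∈ A
    · simp only [hfA h, hRx x ⟨h, hx.1⟩, smul_eq_mul]; ring
    · exact if_neg h
  have hfB' : EqOn f' (fun x => (3 : ℝ) • T₁ 1 x - (3 : ℝ) • T₁ 2 x + T₁ 3 x) (B ∩ V) := by
    intro x hx
    by_cases h : x ∈ A
    · simp only [hfA' h, hT₁, hRx x ⟨h, hx.1⟩]
      ext v
      simp [hR₁]
      ring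
    · exact if_neg h
  have hfB'' : EqOn f'' (fun x => (3 : ℝ) • T₂ 1 x - (3 : ℝ) • T₂ 2 x + T₂ 3 x) (B ∩ V) := by
    intro x hx
    by_cases h : x ∈ A
    · simp only [hfA'' h, hT₂, hRx x ⟨h, hx.1⟩]
      ext v v'
      simp [hR₁, hR₂]
      ring
    · exact if_neg h
  refine ⟨f, hfA, contDiffOn_two_of_hasFDerivAt hV (f' := f') (f'' := f'') (fun x hx => ?_)
    (fun x hx => ?_) fun x hx => ContinuousAt.continuousWithinAt ?_⟩
  · refine hasFDerivAt_of_hasFDerivWithinAt_of_closed_cover hA hB hAB hV (fun y hy => ?_)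
      (fun y hy => ?_) hx
    · rw [hfA' hy]; exact (hκ1 y hy).congr hfA (hfA hy)
    · rw [hfB' hy]
      exact ((((h1 1 i1 y hy).const_smul (3 : ℝ)).sub ((h1 2 i2 y hy).const_smul (3 : ℝ))).add
        (h1 3 i3 y hy)).congr hfB (hfB hy)
  · refine hasFDerivAt_of_hasFDerivWithinAt_of_closed_cover hA hB hAB hV (fun y hy => ?_)
      (fun y hy => ?_) hx
    · rw [hfA'' hy]; exact (hκ2 y hy).congr hfA' (hfA' hy)
    · rw [hfB'' hy]
      exact ((((h2 1 i1 y hy).const_smul (3 : ℝ)).sub ((h2 2 i2 y hy).const_smul (3 : ℝ))).add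
        (h2 3 i3 y hy)).congr hfB' (hfB' hy)
  · clear_value f f' f'' T₁ T₂ R R₁ R₂ D₂
    have hc := continuousOn_third_difference (F := E →L[ℝ] E →L[ℝ] ℝ) (h3 1 i1) (h3 2 i2) (h3 3 i3)
    have hA'' : ContinuousOn f'' A := hD₂c.congr hfA''
    have hB'' : ContinuousOn f'' (B ∩ V) := hc.congr hfB''
    exact continuousAt_of_continuousOn_closed_cover hA hB hAB hV hA'' hB'' hx

end Reflection

/-! ### Extension of `C²` functions from the closure -/

section Extension

variable {d : ℕ} {Ω : Set (EuclideanSpace ℝ (Fin d))} {x₀ : EuclideanSpace ℝ (Fin d)}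
  {g : EuclideanSpace ℝ (Fin d) → ℝ}

/-- A smooth nonincreasing function equal to `1` on `(-∞, a]` and to `0` on `[b, ∞)`. -/
noncomputable def smoothCutoff (a b s : ℝ) : ℝ := Real.smoothTransition ((b - s) / (b - a))

theorem contDiff_smoothCutoff (a b : ℝ) : ContDiff ℝ 2 (smoothCutoff a b) :=
  Real.smoothTransition.contDiff.comp ((contDiff_const.sub contDiff_id).div_const _)

theorem smoothCutoff_eq_one {a b s : ℝ} (hab : a < b) (hs : s ≤ a) : smoothCutoff a b s = 1 :=
  Real.smoothTransition.one_of_one_le ((one_le_div (sub_pos.2 hab)).2 (by linarith))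

theorem smoothCutoff_eq_zero {a b s : ℝ} (hab : a < b) (hs : b ≤ s) : smoothCutoff a b s = 0 :=
  Real.smoothTransition.zero_of_nonpos
    (div_nonpos_of_nonpos_of_nonneg (by linarith) (by linarith))

theorem smoothCutoff_mem_Icc (a b s : ℝ) : smoothCutoff a b s ∈ Icc (0 : ℝ) 1 :=
  ⟨Real.smoothTransition.nonneg _, Real.smoothTransition.le_one _⟩

theorem antitone_smoothCutoff {a b : ℝ} (hab : a < b) : Antitone (smoothCutoff a b) :=
  fun s t hst => Real.smoothTransition.monotone
    (div_le_div_of_nonneg_right (by linarith) (sub_nonneg.2 hab.le))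

namespace IsRadialGauge

/-- A `C²` function of `g` is `C²` also at the centre if it is constant inside `Ω`. -/
theorem contDiff_comp (hg : IsRadialGauge Ω x₀ g) {ρ : ℝ → ℝ} (hρ : ContDiff ℝ 2 ρ) {c : ℝ}
    (hc : ∀ s ≤ 1, ρ s = c) : ContDiff ℝ 2 fun x => ρ (g x) := by
  rw [contDiff_iff_contDiffAt]
  intro x
  by_cases hx : x = x₀
  · have hlt : g x < 1 := by rw [hx, hg.apply_center]; exact one_pos
    refine (contDiffAt_const (c := c)).congr_of_eventuallyEq ?_
    filter_upwards [hg.continuous.continuousAt.eventually (gt_mem_nhds hlt)] with y hy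
    exact hc _ hy.le
  · exact hρ.contDiffAt.comp x (hg.contDiffAt x hx)

/-- Every `C²` function on the closure of `Ω` extends to a `C²` function on the whole space, by
radial reflection at the boundary. -/
theorem exists_contDiff_extension (hg : IsRadialGauge Ω x₀ g) (hconv : Convex ℝ Ω)
    {κ : EuclideanSpace ℝ (Fin d) → ℝ} (hκ : ContDiffOn ℝ 2 κ (closure Ω)) :
    ∃ f : EuclideanSpace ℝ (Fin d) → ℝ, ContDiff ℝ 2 f ∧ EqOn f κ (closure Ω) := by
  have hx₀ : x₀ ∈ Ω := (hg.lt_one_iff x₀).1 (by rw [hg.apply_center]; exact one_pos)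
  have hB : IsClosed {x | 1 ≤ g x} := isClosed_le continuous_const hg.continuous
  have hV : IsOpen {x | g x < 3 / 2} := isOpen_lt hg.continuous continuous_const
  have huniq : UniqueDiffOn ℝ (closure Ω) := uniqueDiffOn_convex hconv.closure
    ⟨x₀, interior_mono subset_closure (hg.isOpen.interior_eq.symm ▸ hx₀)⟩
  set Z : EuclideanSpace ℝ (Fin d) → EuclideanSpace ℝ (Fin d) :=
    fun x => (1 - (g x)⁻¹) • (x - x₀) with hZdef
  have hcover : closure Ω ∪ {x | 1 ≤ g x} = univ := by
    refine eq_univ_of_forall fun x => ?_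
    rcases le_total (g x) 1 with h | h
    · exact Or.inl ((hg.le_one_iff x).1 h)
    · exact Or.inr h
  have hZ : ∀ x ∈ {x | 1 ≤ g x} ∩ {x | g x < 3 / 2}, ContDiffAt ℝ 2 Z x := by
    rintro x ⟨hx, -⟩
    have hgx : 0 < g x := one_pos.trans_le hx
    exact (contDiffAt_const.sub ((hg.contDiffAt x (hg.ne_center_of_pos hgx)).inv hgx.ne')).smul
      (contDiffAt_id.sub contDiffAt_const)
  have hmaps : ∀ x ∈ {x | 1 ≤ g x} ∩ {x | g x < 3 / 2}, ∀ a ∈ Icc (1 : ℝ) 3,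
      x - a • Z x ∈ closure Ω := by
    rintro x ⟨hx, hxV⟩ a ha
    have hx : 1 ≤ g x := hx
    have hxV : g x < 3 / 2 := hxV
    have hgx : 0 < g x := one_pos.trans_le hx
    have h1 : 2 / 3 ≤ (g x)⁻¹ := by
      rw [le_inv_comm₀ (by norm_num) hgx]; norm_num; exact hxV.le
    have h2 : (g x)⁻¹ ≤ 1 := inv_le_one_of_one_le₀ hx
    have h3 : 0 ≤ 1 - a * (1 - (g x)⁻¹) := by nlinarith [ha.1, ha.2]
    have h4 := hg.homogeneous _ h3 (x - x₀)
    rw [add_sub_cancel] at h4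
    rw [← hg.le_one_iff, show x - a • (1 - (g x)⁻¹) • (x - x₀) =
      x₀ + (1 - a * (1 - (g x)⁻¹)) • (x - x₀) by module, h4]
    have h5 : (1 - a * (1 - (g x)⁻¹)) * g x = g x - a * (g x - 1) := by
      field_simp
    rw [h5]
    nlinarith [ha.1]
  have hZ0 : ∀ x ∈ closure Ω ∩ {x | 1 ≤ g x}, Z x = 0 := by
    rintro x ⟨hxA, hxB⟩
    have : g x = 1 := le_antisymm ((hg.le_one_iff x).2 hxA) hxB
    simp [hZdef, this]
  obtain ⟨f, hfκ, hf⟩ := exists_contDiffOn_extension_of_reflection isClosed_closure hB hcover hV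
    huniq hκ hZ hmaps hZ0
  refine ⟨fun x => smoothCutoff (5 / 4) (11 / 8) (g x) * f x, ?_, fun x hx => ?_⟩
  · rw [contDiff_iff_contDiffAt]
    intro x
    by_cases hx : g x < 3 / 2
    · exact (hg.contDiff_comp (contDiff_smoothCutoff _ _)
        (fun s hs => smoothCutoff_eq_one (by norm_num) (by linarith))).contDiffAt.mul
        (hf.contDiffAt (hV.mem_nhds hx))
    · refine (contDiffAt_const (c := (0 : ℝ))).congr_of_eventuallyEq ?_
      have hlt : 11 / 8 < g x := by rw [not_lt] at hx; linarith
      filter_upwards [hg.continuous.continuousAt.eventually (lt_mem_nhds hlt)] with y hy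
      rw [smoothCutoff_eq_zero (by norm_num) hy.le, zero_mul]
  · have := (hg.le_one_iff x).2 hx
    simp only
    rw [smoothCutoff_eq_one (by norm_num) (by linarith), one_mul, hfκ hx]

end IsRadialGauge

end Extension

/-! ### Domination of `o(s)` by the derivative of a `C²` function -/

section Modulus

/-- A continuous nondecreasing function vanishing on `(-∞, 0]` which decays as slowly at `0` as
prescribed: the sum of the ramps `2⁻ᵏ min(1, t⁺ / δ k)`. -/
theorem exists_continuous_monotone_ge {δ : ℕ → ℝ} (hδ : ∀ k, 0 < δ k) :
    ∃ b : ℝ → ℝ, Continuous b ∧ Monotone b ∧ (∀ t ≤ 0, b t = 0) ∧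
      ∀ k, ∀ t, δ k ≤ 2 * t → (1 / 2) ^ (k + 1) ≤ b t := by
  set c : ℕ → ℝ → ℝ := fun k t => (1 / 2) ^ k * min 1 (max t 0 / δ k) with hc
  have hc0 : ∀ k t, 0 ≤ c k t := fun k t =>
    mul_nonneg (by positivity) (le_min zero_le_one (div_nonneg (le_max_right _ _) (hδ k).le))
  have hc1 : ∀ k t, c k t ≤ (1 / 2) ^ k := fun k t =>
    mul_le_of_le_one_right (by positivity) (min_le_left _ _)
  have hs : ∀ t, Summable fun k => c k t := fun t =>
    Summable.of_nonneg_of_le (fun k => hc0 k t) (fun k => hc1 k t) summable_geometric_two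
  refine ⟨fun t => ∑' k, c k t, ?_, fun s t hst => ?_, fun t ht => ?_, fun k t ht => ?_⟩
  · refine continuous_tsum (fun k => ?_) summable_geometric_two fun k t => ?_
    · exact continuous_const.mul (continuous_const.min
        ((continuous_id.max continuous_const).div_const _))
    · rw [Real.norm_of_nonneg (hc0 k t)]; exact hc1 k t
  · refine (hs s).tsum_le_tsum (fun k => ?_) (hs t)
    have := (hδ k).le
    simp only [hc]
    gcongr
  · simp [hc, max_eq_right ht]
  · refine le_trans ?_ ((hs t).le_tsum k fun j _ => hc0 j t)
    have ht0 : 0 < t := by linarith [hδ k]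
    have h1 : 1 / 2 ≤ min 1 (max t 0 / δ k) := by
      refine le_min (by norm_num) ?_
      rw [max_eq_left ht0.le, le_div_iff₀ (hδ k)]
      linarith
    rw [pow_succ]
    exact mul_le_mul_of_nonneg_left h1 (by positivity)

/-- Quantities which are `o(s)` as `s → 0+` are dominated by the derivative of a `C²` function
vanishing on `(-∞, 0]`. -/
theorem exists_contDiff_deriv_ge {S : Set (ℝ × ℝ)}
    (hS : ∀ ε > 0, ∃ δ > 0, ∀ z ∈ S, 0 < z.1 → z.1 < δ → z.2 ≤ ε * z.1) :
    ∃ θ : ℝ → ℝ, ContDiff ℝ 2 θ ∧ (∀ s ≤ 0, θ s = 0) ∧ (∀ s, 0 ≤ deriv θ s) ∧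
      ∃ δ > 0, ∀ z ∈ S, 0 < z.1 → z.1 < δ → z.2 ≤ deriv θ z.1 := by
  choose δ' hδ' hSδ' using fun k : ℕ => hS ((1 / 2) ^ k) (by positivity)
  set δ : ℕ → ℝ := fun k => min (δ' k) (1 / (k + 1)) with hδdef
  have hδ : ∀ k, 0 < δ k := fun k => lt_min (hδ' k) (by positivity)
  obtain ⟨b, hbc, hbm, hb0, hb⟩ := exists_continuous_monotone_ge hδ
  have hbpos : ∀ t, 0 ≤ b t := fun t => by
    rcases le_total t 0 with h | h
    · exact (hb0 t h).ge
    · exact (hb0 0 le_rfl).ge.trans (hbm h)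
  -- `∫₀ˢ b ≥ (s / 2) b(s / 2)`, and `b(s / 2)` is at least a quarter of `2⁻ᵏ`, where `k` is the scale
  -- of `s` chosen below; this accounts for the factor `8`
  set β : ℝ → ℝ := fun s => 8 * ∫ t in (0 : ℝ)..s, b t with hβ
  have hβd : ∀ s, HasDerivAt β (8 * b s) s := fun s =>
    (hbc.integral_hasStrictDerivAt 0 s).hasDerivAt.const_mul 8
  have hβc : Continuous β := continuous_iff_continuousAt.2 fun s => (hβd s).continuousAt
  have hvanish : ∀ {f : ℝ → ℝ}, (∀ t ≤ 0, f t = 0) → ∀ s ≤ 0, ∫ t in (0 : ℝ)..s, f t = 0 := by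
    intro f hf s hs
    rw [intervalIntegral.integral_congr (g := fun _ => 0) fun t ht => ?_]
    · simp
    · rw [uIcc_of_ge hs] at ht
      exact hf t ht.2
  have hβ0 : ∀ s ≤ 0, β s = 0 := fun s hs => by
    simp only [hβ]
    rw [hvanish hb0 s hs, mul_zero]
  set θ : ℝ → ℝ := fun s => ∫ t in (0 : ℝ)..s, β t with hθ
  have hθd : ∀ s, HasDerivAt θ (β s) s := fun s =>
    (hβc.integral_hasStrictDerivAt 0 s).hasDerivAt
  have hθ' : deriv θ = β := funext fun s => (hθd s).deriv
  refine ⟨θ, ?_, hvanish hβ0, fun s => ?_, δ 0, hδ 0, fun z hz hz0 hzδ => ?_⟩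
  · rw [show (2 : WithTop ℕ∞) = 1 + 1 by norm_num, contDiff_succ_iff_deriv]
    refine ⟨fun s => (hθd s).differentiableAt, by simp, ?_⟩
    rw [hθ', contDiff_one_iff_deriv]
    refine ⟨fun s => (hβd s).differentiableAt, ?_⟩
    rw [show deriv β = fun s => 8 * b s from funext fun s => (hβd s).deriv]
    exact continuous_const.mul hbc
  · rw [hθ']
    rcases le_total s 0 with h | h
    · exact (hβ0 s h).ge
    · exact mul_nonneg (by norm_num) (intervalIntegral.integral_nonneg h fun t _ => hbpos t)
  · rw [hθ']
    set s := z.1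
    -- the scale `k` of `s`
    have hex : ∃ k, δ (k + 1) ≤ s := by
      obtain ⟨k, hk⟩ := exists_nat_one_div_lt hz0
      refine ⟨k, (min_le_right _ _).trans (le_trans ?_ hk.le)⟩
      push_cast
      exact one_div_le_one_div_of_le (by positivity) (by linarith)
    classical
    obtain ⟨k, hk1, hk2⟩ : ∃ k, δ (k + 1) ≤ s ∧ s < δ k := by
      refine ⟨Nat.find hex, Nat.find_spec hex, ?_⟩
      rcases h : Nat.find hex with _ | j
      · exact hzδ
      · exact not_le.1 (Nat.find_min hex (m := j) (by omega))
    have h1 : z.2 ≤ (1 / 2) ^ k * s := hSδ' k z hz hz0 (hk2.trans_le (min_le_left _ _))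
    have h2 : (1 / 2) ^ (k + 2) ≤ b (s / 2) := hb (k + 1) (s / 2) (by linarith)
    have h3 : (1 / 2) ^ (k + 2) * (s / 2) ≤ ∫ t in (0 : ℝ)..s, b t := by
      have h4 : ∫ _ in (s / 2)..s, b (s / 2) ≤ ∫ t in (s / 2)..s, b t :=
        intervalIntegral.integral_mono_on (by linarith) intervalIntegrable_const
          (hbc.intervalIntegrable _ _) fun t ht => hbm ht.1
      have h5 : 0 ≤ ∫ t in (0 : ℝ)..(s / 2), b t :=
        intervalIntegral.integral_nonneg (by linarith) fun t _ => hbpos t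
      rw [intervalIntegral.integral_const, smul_eq_mul, show s - s / 2 = s / 2 by ring] at h4
      rw [← intervalIntegral.integral_add_adjacent_intervals
        (hbc.intervalIntegrable 0 (s / 2)) (hbc.intervalIntegrable (s / 2) s)]
      nlinarith
    have h6 : (1 / 2 : ℝ) ^ (k + 2) = (1 / 2) ^ k / 4 := by ring
    rw [h6] at h3
    simp only [hβ]
    linarith

end Modulus

/-! ### Correction outside the domain -/

section NormalMonotonicity

variable {d : ℕ} {Ω : Set (EuclideanSpace ℝ (Fin d))} {x₀ : EuclideanSpace ℝ (Fin d)}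
  {g : EuclideanSpace ℝ (Fin d) → ℝ}

namespace IsRadialGauge

theorem isCompact_le (hg : IsRadialGauge Ω x₀ g) (c : ℝ) : IsCompact {x | g x ≤ c} := by
  obtain ⟨C, hC0, hC⟩ := hg.norm_le
  refine (isCompact_closedBall x₀ (C * c)).of_isClosed_subset
    (isClosed_le hg.continuous continuous_const) fun x hx => ?_
  have h := hC (x - x₀)
  rw [add_sub_cancel] at h
  rw [Metric.mem_closedBall, dist_eq_norm]
  exact h.trans (mul_le_mul_of_nonneg_left hx hC0.le)

theorem isCompact_frontier (hg : IsRadialGauge Ω x₀ g) : IsCompact (frontier Ω) :=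
  (hg.isCompact_le 1).of_isClosed_subset isClosed_frontier fun _ hx =>
    (hg.mem_frontier_iff.1 hx).le

theorem fderiv_levelNormal (p : EuclideanSpace ℝ (Fin d)) :
    fderiv ℝ g p (levelNormal g p) = ‖gradient g p‖ := by
  rw [← inner_gradient_left, levelNormal, real_inner_smul_right, real_inner_self_eq_norm_sq,
    pow_two, ← mul_assoc]
  rcases eq_or_ne ‖gradient g p‖ 0 with h | h
  · rw [h, mul_zero]
  · rw [inv_mul_cancel₀ h, one_mul]

/-- Along outward normal lines, `g` increases at a rate bounded from below. -/
theorem exists_normal_growth (hg : IsRadialGauge Ω x₀ g) :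
    ∃ C > 0, ∀ p ∈ frontier Ω, ∀ r > 0,
      r ≤ C * (g (p + r • levelNormal g p) - 1) ∧
      1 ≤ C * fderiv ℝ g (p + r • levelNormal g p) (levelNormal g p) := by
  obtain ⟨C, hC0, hC⟩ := hg.norm_le
  refine ⟨C, hC0, fun p hp r hr => ?_⟩
  have hgp := hg.mem_frontier_iff.1 hp
  have hp0 := hg.ne_center hp
  have h1 : 1 ≤ C * ‖gradient g p‖ := by
    have h2 := hg.fderiv_radial hp0
    have h3 := hC (p - x₀)
    rw [add_sub_cancel, hgp, mul_one] at h3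
    rw [hgp, ← inner_gradient_left] at h2
    calc 1 = inner ℝ (gradient g p) (p - x₀) := h2.symm
      _ ≤ ‖gradient g p‖ * ‖p - x₀‖ := real_inner_le_norm _ _
      _ ≤ C * ‖gradient g p‖ := by rw [mul_comm]; gcongr
  have h4 := hg.tangent_le hp0 (p + r • levelNormal g p)
  rw [add_sub_cancel_left, map_smul, fderiv_levelNormal, hgp, smul_eq_mul] at h4
  have h5 : r ≤ C * (g (p + r • levelNormal g p) - 1) := by
    calc r ≤ r * (C * ‖gradient g p‖) := le_mul_of_one_le_right hr.le h1
      _ = C * (r * ‖gradient g p‖) := by ring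
      _ ≤ _ := by gcongr; linarith
  refine ⟨h5, ?_⟩
  have hx0 : p + r • levelNormal g p ≠ x₀ := hg.ne_center_of_pos (by
    have : 0 ≤ r * ‖gradient g p‖ := by positivity
    linarith)
  have h6 := hg.tangent_le hx0 p
  rw [show p - (p + r • levelNormal g p) = -(r • levelNormal g p) by abel, map_neg, map_smul,
    hgp, smul_eq_mul] at h6
  have h7 : r * 1 ≤ r * (C * fderiv ℝ g (p + r • levelNormal g p) (levelNormal g p)) := by
    calc r * 1 ≤ C * (g (p + r • levelNormal g p) - 1) := by rw [mul_one]; exact h5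
      _ ≤ C * (r * fderiv ℝ g (p + r • levelNormal g p) (levelNormal g p)) := by
        gcongr; linarith
      _ = _ := by ring
  exact le_of_mul_le_mul_left h7 hr

theorem monotoneOn_normal (hg : IsRadialGauge Ω x₀ g) {p : EuclideanSpace ℝ (Fin d)}
    (hp : p ∈ frontier Ω) : MonotoneOn (fun r : ℝ => g (p + r • levelNormal g p)) (Ici 0) := by
  obtain ⟨C, hC0, hC⟩ := hg.exists_normal_growth
  have hd : ∀ r : ℝ, 0 < r → HasDerivAt (fun r : ℝ => g (p + r • levelNormal g p))
      (fderiv ℝ g (p + r • levelNormal g p) (levelNormal g p)) r := fun r hr => by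
    have h1 : HasDerivAt (fun r : ℝ => p + r • levelNormal g p) (levelNormal g p) r := by
      simpa using ((hasDerivAt_id r).smul_const (levelNormal g p)).const_add p
    have h2 := (hC p hp r hr).1
    exact (hg.hasFDerivAt (hg.ne_center_of_pos
      (by have := pos_of_mul_pos_right (hr.trans_le h2) hC0.le; linarith))).comp_hasDerivAt r h1
  refine monotoneOn_of_deriv_nonneg (convex_Ici 0) ?_ (fun r hr => ?_) fun r hr => ?_
  · exact (hg.continuous.comp (by fun_prop)).continuousOn
  · rw [interior_Ici] at hr
    exact (hd r hr).differentiableAt.differentiableWithinAt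
  · rw [interior_Ici] at hr
    rw [(hd r hr).deriv]
    exact (pos_of_mul_pos_right (one_pos.trans_le (hC p hp r hr).2) hC0.le).le

/-- If at each boundary point the first normal derivative of `f` is negative, or the first two
normal derivatives vanish, then the normal derivative at distance `r` outside is at most `o(r)`,
uniformly on the boundary. -/
theorem normal_derivative_le (hg : IsRadialGauge Ω x₀ g) {f : EuclideanSpace ℝ (Fin d) → ℝ}
    (hf : ContDiff ℝ 2 f)
    (hbd : ∀ p ∈ frontier Ω, fderiv ℝ f p (levelNormal g p) < 0 ∨
      (fderiv ℝ f p (levelNormal g p) = 0 ∧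
        fderiv ℝ (fderiv ℝ f) p (levelNormal g p) (levelNormal g p) = 0))
    {ε : ℝ} (hε : 0 < ε) :
    ∃ δ > 0, ∀ r, 0 < r → r < δ → ∀ p ∈ frontier Ω,
      fderiv ℝ f (p + r • levelNormal g p) (levelNormal g p) ≤ ε * r := by
  have hf1 : ContDiff ℝ 1 (fderiv ℝ f) := hf.fderiv_right (by norm_num)
  have hf2 : Continuous (fderiv ℝ (fderiv ℝ f)) := hf1.continuous_fderiv one_ne_zero
  have key : ∀ᶠ r in 𝓝 (0 : ℝ), ∀ p ∈ frontier Ω, p ∈ frontier Ω → 0 < r →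
      fderiv ℝ f (p + r • levelNormal g p) (levelNormal g p) ≤ ε * r := by
    refine hg.isCompact_frontier.eventually_forall_of_forall_eventually fun p₀ hp₀ => ?_
    have hn : ContinuousAt (fun z : ℝ × EuclideanSpace ℝ (Fin d) => levelNormal g z.2) (0, p₀) :=
      ContinuousAt.comp (f := Prod.snd) (x := ((0 : ℝ), p₀))
        (hg.continuousAt_levelNormal (hg.ne_center hp₀)) continuousAt_snd
    have hx : ContinuousAt (fun z : ℝ × EuclideanSpace ℝ (Fin d) =>
        z.2 + z.1 • levelNormal g z.2) (0, p₀) :=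
      continuousAt_snd.add (continuousAt_fst.smul hn)
    have hq : ContinuousAt (fun z : ℝ × EuclideanSpace ℝ (Fin d) =>
        fderiv ℝ f (z.2 + z.1 • levelNormal g z.2) (levelNormal g z.2)) (0, p₀) :=
      (hf1.continuous.continuousAt.comp hx).clm_apply hn
    have hQ : ContinuousAt (fun z : ℝ × EuclideanSpace ℝ (Fin d) =>
        fderiv ℝ (fderiv ℝ f) (z.2 + z.1 • levelNormal g z.2) (levelNormal g z.2)
          (levelNormal g z.2)) (0, p₀) :=
      ((hf2.continuousAt.comp hx).clm_apply hn).clm_apply hn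
    rcases hbd p₀ hp₀ with h | ⟨-, h⟩
    · filter_upwards [hq.eventually (gt_mem_nhds (by simpa using h))] with z hz _ hr
      exact hz.le.trans (mul_pos hε hr).le
    · have hev : ∀ᶠ z in 𝓝 ((0 : ℝ), p₀),
          fderiv ℝ (fderiv ℝ f) (z.2 + z.1 • levelNormal g z.2) (levelNormal g z.2)
            (levelNormal g z.2) < ε :=
        hQ.eventually (gt_mem_nhds (by simpa [h] using hε))
      obtain ⟨δ, hδ, hball⟩ := Metric.eventually_nhds_iff_ball.1 hev
      filter_upwards [Metric.ball_mem_nhds _ hδ] with z hz hzp hr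
      set p := z.2
      set n := levelNormal g p
      have hd : ∀ s : ℝ, HasDerivAt (fun s : ℝ => fderiv ℝ f (p + s • n) n)
          (fderiv ℝ (fderiv ℝ f) (p + s • n) n n) s := fun s => by
        have h1 : HasDerivAt (fun s : ℝ => p + s • n) n s := by
          simpa using ((hasDerivAt_id s).smul_const n).const_add p
        have h2 := ((hf1.differentiable one_ne_zero (p + s • n)).hasFDerivAt).comp_hasDerivAt s h1
        simpa using h2.clm_apply (hasDerivAt_const s n)
      -- mean value theorem between `p`, where the normal derivative is nonpositive, and `p + r n`
      obtain ⟨ρ, hρ, hρ'⟩ := exists_hasDerivAt_eq_slope _ _ hr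
        (fun s _ => (hd s).continuousAt.continuousWithinAt) fun s _ => hd s
      have h3 : fderiv ℝ (fderiv ℝ f) (p + ρ • n) n n < ε := by
        refine hball (ρ, p) ?_
        rw [← ball_prod_same] at hz ⊢
        refine ⟨?_, hz.2⟩
        have h4 := hz.1
        rw [Metric.mem_ball, Real.dist_0_eq_abs, abs_of_pos hr] at h4
        rw [Metric.mem_ball, Real.dist_0_eq_abs, abs_of_pos hρ.1]
        exact hρ.2.trans h4
      have h5 : fderiv ℝ f p n ≤ 0 := by
        rcases hbd p hzp with h | h
        · exact h.le
        · exact h.1.le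
      rw [hρ', div_lt_iff₀ (by linarith)] at h3
      simp only [zero_smul, add_zero, sub_zero] at h3
      linarith
  obtain ⟨δ, hδ, hball⟩ := Metric.eventually_nhds_iff_ball.1 key
  refine ⟨δ, hδ, fun r hr hrδ p hp => hball r ?_ p hp hp hr⟩
  rwa [Metric.mem_ball, Real.dist_0_eq_abs, abs_of_pos hr]

/-- A `C²` function whose normal derivative is `o(r)` outside `Ω` can be corrected outside `Ω` so
that it does not increase along the outward normal rays and keeps its strict lower bound `c` on the
closure as a bound everywhere. The correction subtracts `θ (g - 1)` and then cuts off towards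
`c`. -/
theorem exists_antitone_correction (hg : IsRadialGauge Ω x₀ g)
    {f : EuclideanSpace ℝ (Fin d) → ℝ} (hf : ContDiff ℝ 2 f)
    (hbd : ∀ p ∈ frontier Ω, fderiv ℝ f p (levelNormal g p) < 0 ∨
      (fderiv ℝ f p (levelNormal g p) = 0 ∧
        fderiv ℝ (fderiv ℝ f) p (levelNormal g p) (levelNormal g p) = 0))
    {c : ℝ} (hc : ∀ x ∈ closure Ω, c < f x) :
    ∃ h : EuclideanSpace ℝ (Fin d) → ℝ, ContDiff ℝ 2 h ∧ EqOn h f (closure Ω) ∧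
      (∀ x, c ≤ h x) ∧
      ∀ p ∈ frontier Ω, AntitoneOn (fun r : ℝ => h (p + r • levelNormal g p)) (Ici 0) := by
  obtain ⟨C, hC0, hC⟩ := hg.exists_normal_growth
  obtain ⟨θ, hθ, hθ0, hθ', δ, hδ, hδθ⟩ := exists_contDiff_deriv_ge
    (S := {z | ∃ p ∈ frontier Ω, ∃ r : ℝ, 0 < r ∧
      z.1 = g (p + r • levelNormal g p) - 1 ∧
      z.2 = C * fderiv ℝ f (p + r • levelNormal g p) (levelNormal g p)}) (by
    intro ε hε
    obtain ⟨δ, hδ, h⟩ := hg.normal_derivative_le hf hbd (ε := ε / C / C) (by positivity)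
    refine ⟨δ / C, by positivity, ?_⟩
    rintro ⟨s, y⟩ ⟨p, hp, r, hr, rfl, rfl⟩ - hs
    have h1 := (hC p hp r hr).1
    have h2 := h r hr (h1.trans_lt ((lt_div_iff₀' hC0).1 hs)) p hp
    calc C * fderiv ℝ f (p + r • levelNormal g p) (levelNormal g p)
        ≤ C * (ε / C / C * (C * (g (p + r • levelNormal g p) - 1))) := by
          gcongr
          exact h2.trans (by gcongr)
      _ = ε * (g (p + r • levelNormal g p) - 1) := by field_simp)
  -- the corrected function, before the cutoff; the factors `C` in the set above turn the
  -- estimate in terms of `r` into one in terms of `s = g - 1`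
  set k : EuclideanSpace ℝ (Fin d) → ℝ := fun x => f x - θ (g x - 1) with hk
  have hkC : ContDiff ℝ 2 k := hf.sub (hg.contDiff_comp (ρ := fun s => θ (s - 1))
    (hθ.comp (contDiff_id.sub contDiff_const)) (c := 0) fun s hs => hθ0 _ (by linarith))
  have hkf : ∀ x ∈ closure Ω, k x = f x := fun x hx => by
    simp only [hk]
    rw [hθ0 _ (by linarith [(hg.le_one_iff x).2 hx]), sub_zero]
  -- by compactness `k` exceeds `c` in a neighbourhood of the closure of `Ω`
  obtain ⟨e, he, heδ, hek⟩ : ∃ e > 0, e ≤ δ ∧ ∀ x, g x ≤ 1 + e → c ≤ k x := by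
    have hK : IsCompact ({x | g x ≤ 2} ∩ {x | k x ≤ c}) :=
      (hg.isCompact_le 2).inter_right (isClosed_le hkC.continuous continuous_const)
    rcases ({x | g x ≤ 2} ∩ {x | k x ≤ c}).eq_empty_or_nonempty with hemp | hne
    · refine ⟨min δ 1, by positivity, min_le_left _ _, fun x hx => ?_⟩
      by_contra hlt
      exact hemp.subset (show x ∈ _ from
        ⟨show g x ≤ 2 by linarith [min_le_right δ 1], (not_le.1 hlt).le⟩)
    · obtain ⟨z, hz, hmin⟩ := hK.exists_isMinOn hne hg.continuous.continuousOn
      have hz1 : 1 < g z := by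
        by_contra h
        have hzc := (hg.le_one_iff z).1 (not_lt.1 h)
        exact absurd hz.2 (not_le.2 (hkf z hzc ▸ hc z hzc))
      refine ⟨min δ (min 1 ((g z - 1) / 2)), by have := sub_pos.2 hz1; positivity,
        min_le_left _ _, fun x hx => ?_⟩
      by_contra hlt
      have h1 : min δ (min 1 ((g z - 1) / 2)) ≤ 1 := (min_le_right _ _).trans (min_le_left _ _)
      have h2 : min δ (min 1 ((g z - 1) / 2)) ≤ (g z - 1) / 2 :=
        (min_le_right _ _).trans (min_le_right _ _)
      have h3 : g z ≤ g x := hmin ⟨show g x ≤ 2 by linarith, (not_le.1 hlt).le⟩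
      linarith
  have hcut : 1 + e / 2 < 1 + e := by linarith
  refine ⟨fun x => c + smoothCutoff (1 + e / 2) (1 + e) (g x) * (k x - c), ?_, fun x hx => ?_,
    fun x => ?_, fun p hp => ?_⟩
  · exact contDiff_const.add ((hg.contDiff_comp (contDiff_smoothCutoff _ _) (c := 1)
      fun s hs => smoothCutoff_eq_one hcut (by linarith)).mul (hkC.sub contDiff_const))
  · simp only
    rw [smoothCutoff_eq_one hcut (by linarith [(hg.le_one_iff x).2 hx]), hkf x hx]
    ring
  · rcases le_total (g x) (1 + e) with h | h
    · exact le_add_of_nonneg_right (mul_nonneg (smoothCutoff_mem_Icc _ _ _).1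
        (sub_nonneg.2 (hek x h)))
    · simp only
      rw [smoothCutoff_eq_zero hcut h, zero_mul, add_zero]
  · set n := levelNormal g p with hn
    have hgm := hg.monotoneOn_normal hp
    -- before the cutoff the correction makes the normal derivative nonpositive
    have hkm : ∀ R, 0 ≤ R → g (p + R • n) < 1 + e →
        AntitoneOn (fun r : ℝ => k (p + r • n)) (Icc 0 R) := by
      intro R hR hgR
      have hline : ∀ r : ℝ, HasDerivAt (fun r : ℝ => p + r • n) n r := fun r => by
        simpa using ((hasDerivAt_id r).smul_const n).const_add p
      have hdiff : ∀ r : ℝ, HasDerivAt (fun r : ℝ => k (p + r • n))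
          (fderiv ℝ k (p + r • n) n) r := fun r =>
        (hkC.differentiable two_ne_zero _).hasFDerivAt.comp_hasDerivAt r (hline r)
      refine antitoneOn_of_deriv_nonpos (convex_Icc 0 R)
        (fun r _ => (hdiff r).continuousAt.continuousWithinAt)
        (fun r _ => (hdiff r).differentiableAt.differentiableWithinAt) fun r hr => ?_
      rw [interior_Icc] at hr
      have h1 := hC p hp r hr.1
      have hgr0 : 0 < g (p + r • n) - 1 := pos_of_mul_pos_right (hr.1.trans_le h1.1) hC0.le
      have hgrR : g (p + r • n) ≤ g (p + R • n) := hgm hr.1.le hR hr.2.le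
      have h2 := hδθ (g (p + r • n) - 1, C * fderiv ℝ f (p + r • n) n)
        ⟨p, hp, r, hr.1, rfl, rfl⟩ hgr0 (by simp only; linarith)
      have h3 : HasDerivAt (fun r : ℝ => k (p + r • n)) (fderiv ℝ f (p + r • n) n -
          deriv θ (g (p + r • n) - 1) * fderiv ℝ g (p + r • n) n) r := by
        have h4 := (hg.hasFDerivAt (hg.ne_center_of_pos (x := p + r • n)
          (by linarith))).comp_hasDerivAt r (hline r)
        have h5 := (hθ.differentiable two_ne_zero (g (p + r • n) - 1)).hasDerivAt.comp r
          (h4.sub_const 1)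
        exact ((hf.differentiable two_ne_zero _).hasFDerivAt.comp_hasDerivAt r (hline r)).sub h5
      rw [h3.deriv]
      have h6 : C * fderiv ℝ f (p + r • n) n ≤
          C * (deriv θ (g (p + r • n) - 1) * fderiv ℝ g (p + r • n) n) := by
        refine h2.trans ?_
        have := mul_le_mul_of_nonneg_left h1.2 (hθ' (g (p + r • n) - 1))
        linarith
      linarith [le_of_mul_le_mul_left h6 hC0]
    intro r hr R hR hrR
    have hr : 0 ≤ r := hr
    have hgrR : g (p + r • n) ≤ g (p + R • n) := hgm hr hR hrR
    simp only
    -- cutoff and `k - c` are both nonnegative and nonincreasing where the cutoff is positive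
    gcongr c + ?_
    rcases lt_or_ge (g (p + R • n)) (1 + e) with h | h
    · refine mul_le_mul (antitone_smoothCutoff hcut hgrR)
        (sub_le_sub_right (hkm R hR h ⟨hr, hrR⟩ ⟨hR, le_rfl⟩ hrR) c)
        (sub_nonneg.2 (hek _ h.le)) (smoothCutoff_mem_Icc _ _ _).1
    · rw [smoothCutoff_eq_zero hcut h, zero_mul]
      rcases le_total (g (p + r • n)) (1 + e) with h' | h'
      · exact mul_nonneg (smoothCutoff_mem_Icc _ _ _).1 (sub_nonneg.2 (hek _ h'))
      · rw [smoothCutoff_eq_zero hcut h', zero_mul]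

end IsRadialGauge

end NormalMonotonicity

/-! ### Geodesic convexity for the corrected extension -/

theorem propositionA1 {d : ℕ} (Ω : Set (EuclideanSpace ℝ (Fin d)))
    (hΩ_nonempty : Ω.Nonempty) (hΩ_open : IsOpen Ω) (hΩ_bdd : Bornology.IsBounded Ω)
    (hΩ_convex : Convex ℝ Ω) (hΩ_C2 : HasC2Boundary Ω)
    (κ : EuclideanSpace ℝ (Fin d) → ℝ) (κ_lo κ_hi : ℝ) (hκ_lo : 0 < κ_lo)
    (hκ_C2 : ContDiffOn ℝ 2 κ (closure Ω))
    (hκ_bounds : ∀ x ∈ closure Ω, κ_lo ≤ κ x ∧ κ x ≤ κ_hi)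
    (h_mono : NormallyNonincreasing Ω κ)
    (h_bdry : ∀ p ∈ frontier Ω, ∀ ν, IsOutwardUnitNormal Ω p ν →
      fderivWithin ℝ κ (closure Ω) p ν < 0 ∨
        (fderivWithin ℝ κ (closure Ω) p ν = 0 ∧
          fderivWithin ℝ (fderivWithin ℝ κ (closure Ω)) (closure Ω) p ν ν = 0)) :
    ∃ κ' : EuclideanSpace ℝ (Fin d) → ℝ,
      ContDiff ℝ 2 κ' ∧ EqOn κ' κ (closure Ω) ∧
      (∀ x, κ_lo / 2 ≤ κ' x ∧ κ' x ≤ κ_hi) ∧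
      IsDistance (conformalDist κ') ∧
      IsGeodesicallyConvex κ' Ω := by
  obtain ⟨x₀, hx₀⟩ := hΩ_nonempty
  obtain ⟨g, hg⟩ := exists_isRadialGauge hΩ_open hΩ_bdd hΩ_convex hΩ_C2 hx₀
  obtain ⟨f, hf, hfκ⟩ := hg.exists_contDiff_extension hΩ_convex hκ_C2
  have hsub : frontier Ω ⊆ closure Ω := frontier_subset_closure
  have huniq : UniqueDiffOn ℝ (closure Ω) := uniqueDiffOn_convex hΩ_convex.closure
    ⟨x₀, interior_maximal subset_closure hΩ_open hx₀⟩
  have hf1 : ContDiff ℝ 1 (fderiv ℝ f) := hf.fderiv_right (by norm_num)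
  -- the derivatives of `κ` up to the boundary are those of its extension
  have hD1 : EqOn (fderivWithin ℝ κ (closure Ω)) (fderiv ℝ f) (closure Ω) := fun y hy => by
    rw [← (hf.differentiable two_ne_zero y).fderivWithin (huniq y hy)]
    exact fderivWithin_congr (fun z hz => (hfκ hz).symm) (hfκ hy).symm
  have hD2 : EqOn (fderivWithin ℝ (fderivWithin ℝ κ (closure Ω)) (closure Ω))
      (fderiv ℝ (fderiv ℝ f)) (closure Ω) := fun y hy => by
    rw [← (hf1.differentiable one_ne_zero y).fderivWithin (huniq y hy)]
    exact fderivWithin_congr hD1 (hD1 hy)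
  obtain ⟨κ', hC, hκ'f, hlo, hanti⟩ := hg.exists_antitone_correction hf
    (fun p hp => by
      simpa only [hD1 (hsub hp), hD2 (hsub hp)] using
        h_bdry p hp (levelNormal g p) (hg.isOutwardUnitNormal hp))
    (c := κ_lo / 2) fun x hx => by
      rw [hfκ hx]
      linarith [(hκ_bounds x hx).1]
  have heq : EqOn κ' κ (closure Ω) := hκ'f.trans hfκ
  have hbounds : ∀ x, κ_lo / 2 ≤ κ' x ∧ κ' x ≤ κ_hi := fun x => by
    refine ⟨hlo x, ?_⟩
    by_cases hx : x ∈ Ω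
    · rw [heq (subset_closure hx)]
      exact (hκ_bounds x (subset_closure hx)).2
    · have hne : Ωᶜ.Nonempty := ⟨x, hx⟩
      obtain ⟨p, hp, hxp⟩ := hg.exists_eq_add_boundaryDist_smul hne x
      have hb : 0 ≤ boundaryDist Ω x := not_lt.1 fun h => hx ((hg.boundaryDist_neg_iff hne x).1 h)
      have h1 := hanti p hp (mem_Ici.2 le_rfl) (mem_Ici.2 hb) hb
      simp only [zero_smul, add_zero, ← hxp] at h1
      rw [heq (hsub hp)] at h1
      exact h1.trans (hκ_bounds p (hsub hp)).2
  have hC1 : ContDiff ℝ 1 κ' := hC.of_le (by norm_num)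
  have hIcc : ∀ z, κ' z ∈ Icc (κ_lo / 2) κ_hi := hbounds
  obtain ⟨l, hl, hmono⟩ := h_mono
  refine ⟨κ', hC, heq, hbounds, isDistance_conformalDist (half_pos hκ_lo) hIcc hC1,
    hg.isGeodesicallyConvex (half_pos hκ_lo) hIcc hC1 hl fun p hp r hr hr' => ?_⟩
  have hm := hmono p hp _ (hg.isOutwardUnitNormal hp)
  set n := levelNormal g p
  refine (hC1.differentiable one_ne_zero _).hasFDerivAt.apply_le_of_eventually_le ?_
  simp only [mul_zero, add_zero]
  -- outside `Ω` the correction is used, and inside the given monotonicity of `κ` itself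
  rcases le_or_gt 0 r with h0 | h0
  · filter_upwards [self_mem_nhdsWithin] with t ht
    have ht : 0 < t := ht
    have h1 := hanti p hp (mem_Ici.2 h0) (mem_Ici.2 (by linarith : 0 ≤ r + t)) (by linarith)
    simpa only [add_smul, add_assoc] using h1
  · have hin : p + r • n ∈ Ω := hr'.resolve_left (not_le.2 h0)
    have hcont : Tendsto (fun t : ℝ => p + r • n + t • n) (𝓝 0) (𝓝 (p + r • n)) := by
      have h : Continuous fun t : ℝ => p + r • n + t • n := by fun_prop
      simpa using h.tendsto 0
    filter_upwards [self_mem_nhdsWithin,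
      nhdsWithin_le_nhds (hcont (hg.isOpen.mem_nhds hin)),
      nhdsWithin_le_nhds (Iio_mem_nhds (neg_pos.2 h0))] with t ht htΩ htr
    have ht : 0 < t := ht
    have htr : t < -r := htr
    have h1 := hm (a := -r - t) (b := -r) ⟨by linarith, by linarith⟩ ⟨by linarith, by linarith⟩
      (by linarith)
    have e1 : p - (-r - t) • n = p + r • n + t • n := by module
    have e2 : p - (-r) • n = p + r • n := by module
    simp only [e1, e2] at h1
    rwa [heq (subset_closure hin), heq (subset_closure htΩ)]
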